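/- Let $T$ be a finite tree that is not a star (a star is a graph with a vertex $c$ such that its edges are exactly the edges joining $c$ to each of the other vertices; the one-vertex graph counts as a star). Let $x$ be a vertex of $T$ such that it is not the case that $T$ is a path on five vertices with middle vertex $x$. Write $d(y)$ for the degree of a vertex $y$ of $T$ and $\mathrm{dist}$ for the distance in $T$. Then there exists a $(T,x)$-good 2-placement, that is, a permutation $\sigma$ of $V(T)$ with $\sigma(v)\neq v$ for every vertex $v$ and such that 1. $\sigma$ is a 2-placement of $T$: if $uv$ is an edge of $T$, then $\sigma(u)\sigma(v)$ is not an edge of $T$; 2. $\sigma(T)\subseteq T^5$: if $uv$ is an edge of $T$, then $\sigma(u)\sigma(v)$ is an edge of the fifth power $T^5$ of $T$, the graph on $V(T)$ in which two distinct vertices are adjacent if and only if their distance in $T$ is at most $5$; 3. $\mathrm{dist}(x,\sigma(x))=1$; 4. $\mathrm{dist}(y,\sigma(y))\leq 2$ for every neighbour $y$ of $x$; 5. $\mathrm{dist}(y,\sigma(y))\leq 4$ for every vertex $y$ with $d(y)=1$. -/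

import Mathlib

namespace TreePlacement

variable {V : Type*}

/-- A graph is a star if some vertex `c` is joined to every other vertex and there are no
other edges. (The one-vertex graph is the trivial star.) -/
def IsStar (G : SimpleGraph V) : Prop :=
  ∃ c : V, G = SimpleGraph.starGraph c

/-- `x` is a bad vertex of `G`: `G` is a path on five vertices and `x` is its middle vertex. -/
def IsBadVertex (G : SimpleGraph V) (x : V) : Prop :=
  ∃ e : SimpleGraph.pathGraph 5 ≃g G, e 2 = x

/-- The `k`-th power of `G`: distinct vertices are adjacent when they are joined in `G` by a
path and their distance in `G` is at most `k`. -/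
def power (G : SimpleGraph V) (k : ℕ) : SimpleGraph V where
  Adj u v := u ≠ v ∧ G.Reachable u v ∧ G.dist u v ≤ k
  symm := ⟨fun _ _ h => ⟨h.1.symm, h.2.1.symm, G.dist_comm ▸ h.2.2⟩⟩
  loopless := ⟨fun _ h => h.1 rfl⟩

/-- A vertex of degree one. -/
def IsLeaf (G : SimpleGraph V) (y : V) : Prop :=
  (G.neighborSet y).ncard = 1

/-- The image `σ(G)`: its edges are the `σ(u)σ(v)` with `uv` an edge of `G`. -/
def image (σ : Equiv.Perm V) (G : SimpleGraph V) : SimpleGraph V :=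
  G.map σ

/-- A permutation of the vertex set is a 2-placement of `G` (an embedding of `G` into its
complement) if `G` and `σ(G)` have no common edge. -/
def IsTwoPlacement (G : SimpleGraph V) (σ : Equiv.Perm V) : Prop :=
  ∀ u v : V, G.Adj u v → ¬ G.Adj (σ u) (σ v)

/-- `σ` is a `(T, x)`-good 2-placement of the tree `T`. -/
structure IsGoodTwoPlacement (T : SimpleGraph V) (x : V) (σ : Equiv.Perm V) : Prop where
  fixedPointFree : ∀ v : V, σ v ≠ v
  twoPlacement : IsTwoPlacement T σ
  image_le_power : image σ T ≤ power T 5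
  dist_base : T.dist x (σ x) = 1
  dist_neighbor : ∀ y : V, T.Adj x y → T.dist y (σ y) ≤ 2
  dist_leaf : ∀ y : V, IsLeaf T y → T.dist y (σ y) ≤ 4

end TreePlacement

namespace TreePlacement

/-! Root the tree at `x` and use induction on the number of vertices, for the stronger statement
that every vertex, not only every leaf, moves by at most 4 (`GoodMap`). If a vertex has two leaf
children, delete one of them and reinsert it just before its twin in a cycle of the permutation
(`TwinAt.good`). The one new edge is sent to distance at most 1 + 4 = 5, which is where the stronger
bound is needed. So no vertex need have two leaf children (`Reduced`). The conditions on the root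
and its neighbours make gluing possible. A vertex `p` that is the root or a child of the root moves
by 1 or 2. If a branch is permuted within itself and its root lands at distance at most 3 from `p`,
the edge joining it to `p` is sent to a distance between 2 and 5, so the two placements combine
(`good_of_branchMap`). By induction every smaller non-star branch can be glued on like this, `bad`
by an explicit table. In a reduced tree the star branches are only `nil`, `K2` and `P3`, and any two
of them except `nil`, `nil` can be glued on together as a pair. If all root branches are stars,
removing pairs leaves finitely many trees, settled by tables. Otherwise remove a non-star branch. If
the rest is `bad`, its two copies of `K2` are removed instead. If the rest is a star, it has at most
three vertices, and the same dissection is applied at the child of the root that carries the large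
branch. There the remainder is excluded from the induction in just three configurations. In these
the branch is not permuted within itself: its root is sent to a neighbour of `p`, and a vertex
outside takes over the image that the root would have had (`ChainMap.good`). -/

/-- Rooted plane trees: `cons b s` is the tree `s` in which the root got the root of `b` as an
additional (first) child. -/
inductive RTree : Type
  | nil : RTree
  | cons (b s : RTree) : RTree

/-! ### Rooted plane trees and their metric -/

namespace RTree

/-- The vertices of a rooted tree. -/
def Vert : RTree → Type
  | nil => Unit
  | cons b s => Vert b ⊕ Vert s

instance decEqVert : (t : RTree) → DecidableEq t.Vert
  | nil => inferInstanceAs (DecidableEq Unit)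
  | cons b s =>
    have := decEqVert b
    have := decEqVert s
    inferInstanceAs (DecidableEq (b.Vert ⊕ s.Vert))

instance fintypeVert : (t : RTree) → Fintype t.Vert
  | nil => inferInstanceAs (Fintype Unit)
  | cons b s =>
    have := fintypeVert b
    have := fintypeVert s
    inferInstanceAs (Fintype (b.Vert ⊕ s.Vert))

/-- The number of vertices. -/
def size : RTree → ℕ
  | nil => 1
  | cons b s => b.size + s.size

/-- The root. -/
def root : (t : RTree) → t.Vert
  | nil => ()
  | cons _ s => Sum.inr s.root

/-- The distance from the root. -/
def depth : (t : RTree) → t.Vert → ℕ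
  | nil, _ => 0
  | cons b _, Sum.inl a => b.depth a + 1
  | cons _ s, Sum.inr a => s.depth a

/-- The distance between two vertices. -/
def dist : (t : RTree) → t.Vert → t.Vert → ℕ
  | nil, _, _ => 0
  | cons b _, Sum.inl a, Sum.inl a' => b.dist a a'
  | cons b s, Sum.inl a, Sum.inr c => b.depth a + 1 + s.depth c
  | cons b s, Sum.inr c, Sum.inl a => b.depth a + 1 + s.depth c
  | cons _ s, Sum.inr c, Sum.inr c' => s.dist c c'

/-- The vertex at a given place in the list of vertices of `cons b s` that lists those of `b`
first. -/
def vertAt : (t : RTree) → ℕ → t.Vert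
  | nil, _ => ()
  | cons b s, n => if n < b.size then Sum.inl (b.vertAt n) else Sum.inr (s.vertAt (n - b.size))

/-- The place of a vertex in the list of vertices. -/
def index : (t : RTree) → t.Vert → ℕ
  | nil, _ => 0
  | cons b _, Sum.inl a => b.index a
  | cons b s, Sum.inr a => b.size + s.index a

/-- The self-map of the vertices with a given table of values. -/
def ofTable (t : RTree) (L : List ℕ) (a : t.Vert) : t.Vert :=
  t.vertAt (L.getD (t.index a) 0)

section basic

variable (b s : RTree)

@[simp] lemma size_nil : nil.size = 1 := rfl
@[simp] lemma size_cons : (cons b s).size = b.size + s.size := rfl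
@[simp] lemma root_cons : (cons b s).root = Sum.inr s.root := rfl
@[simp] lemma depth_nil (a : nil.Vert) : nil.depth a = 0 := rfl
@[simp] lemma depth_inl (a : b.Vert) : (cons b s).depth (Sum.inl a) = b.depth a + 1 := rfl
@[simp] lemma depth_inr (a : s.Vert) : (cons b s).depth (Sum.inr a) = s.depth a := rfl
@[simp] lemma dist_nil (a c : nil.Vert) : nil.dist a c = 0 := rfl
@[simp] lemma dist_inl_inl (a c : b.Vert) :
    (cons b s).dist (Sum.inl a) (Sum.inl c) = b.dist a c := rfl
@[simp] lemma dist_inl_inr (a : b.Vert) (c : s.Vert) :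
    (cons b s).dist (Sum.inl a) (Sum.inr c) = b.depth a + 1 + s.depth c := rfl
@[simp] lemma dist_inr_inl (a : b.Vert) (c : s.Vert) :
    (cons b s).dist (Sum.inr c) (Sum.inl a) = b.depth a + 1 + s.depth c := rfl
@[simp] lemma dist_inr_inr (a c : s.Vert) :
    (cons b s).dist (Sum.inr a) (Sum.inr c) = s.dist a c := rfl

lemma vert_nil_eq (a c : nil.Vert) : a = c := Subsingleton.elim (α := Unit) a c

lemma size_pos : (t : RTree) → 0 < t.size
  | nil => Nat.one_pos
  | cons b _ => Nat.add_pos_left (size_pos b) _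

@[simp] lemma depth_root : (t : RTree) → t.depth t.root = 0
  | nil => rfl
  | cons _ s => depth_root s

lemma eq_root_of_depth : (t : RTree) → (a : t.Vert) → t.depth a = 0 → a = t.root
  | nil, _, _ => rfl
  | cons _ _, Sum.inl _, h => by simp at h
  | cons _ s, Sum.inr a, h => congrArg Sum.inr (eq_root_of_depth s a h)

lemma depth_pos (t : RTree) {a : t.Vert} (h : a ≠ t.root) : 0 < t.depth a :=
  Nat.pos_of_ne_zero fun h' => h (eq_root_of_depth t a h')

@[simp] lemma dist_self : (t : RTree) → (a : t.Vert) → t.dist a a = 0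
  | nil, _ => rfl
  | cons b _, Sum.inl a => dist_self b a
  | cons _ s, Sum.inr a => dist_self s a

lemma dist_comm : (t : RTree) → (a c : t.Vert) → t.dist a c = t.dist c a
  | nil, _, _ => rfl
  | cons b _, Sum.inl a, Sum.inl c => dist_comm b a c
  | cons _ _, Sum.inl _, Sum.inr _ => rfl
  | cons _ _, Sum.inr _, Sum.inl _ => rfl
  | cons _ s, Sum.inr a, Sum.inr c => dist_comm s a c

lemma eq_of_dist : (t : RTree) → (a c : t.Vert) → t.dist a c = 0 → a = c
  | nil, _, _, _ => rfl
  | cons b _, Sum.inl a, Sum.inl c, h => congrArg Sum.inl (eq_of_dist b a c h)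
  | cons _ _, Sum.inl _, Sum.inr _, h => by simp at h
  | cons _ _, Sum.inr _, Sum.inl _, h => by simp at h
  | cons _ s, Sum.inr a, Sum.inr c, h => congrArg Sum.inr (eq_of_dist s a c h)

lemma dist_pos (t : RTree) {a c : t.Vert} (h : a ≠ c) : 0 < t.dist a c :=
  Nat.pos_of_ne_zero fun h' => h (eq_of_dist t a c h')

@[simp] lemma dist_root : (t : RTree) → (a : t.Vert) → t.dist t.root a = t.depth a
  | nil, _ => rfl
  | cons _ s, Sum.inl a => by simp
  | cons _ s, Sum.inr a => dist_root s a

@[simp] lemma dist_root' (t : RTree) (a : t.Vert) : t.dist a t.root = t.depth a := by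
  rw [dist_comm, dist_root]

lemma depth_le : (t : RTree) → (a c : t.Vert) → t.depth c ≤ t.depth a + t.dist a c
  | nil, _, _ => le_rfl
  | cons b _, Sum.inl a, Sum.inl c => by have := depth_le b a c; simp; omega
  | cons _ _, Sum.inl _, Sum.inr _ => by simp; omega
  | cons _ _, Sum.inr _, Sum.inl _ => by simp; omega
  | cons _ s, Sum.inr a, Sum.inr c => by have := depth_le s a c; simp; omega

lemma dist_le_depth : (t : RTree) → (a c : t.Vert) → t.dist a c ≤ t.depth a + t.depth c
  | nil, _, _ => le_rfl
  | cons b _, Sum.inl a, Sum.inl c => by have := dist_le_depth b a c; simp; omega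
  | cons _ _, Sum.inl _, Sum.inr _ => by simp
  | cons _ _, Sum.inr _, Sum.inl _ => by simp; omega
  | cons _ s, Sum.inr a, Sum.inr c => by have := dist_le_depth s a c; simp; omega

lemma dist_triangle : (t : RTree) → (a c e : t.Vert) → t.dist a e ≤ t.dist a c + t.dist c e
  | nil, _, _, _ => le_rfl
  | cons b _, Sum.inl a, Sum.inl c, Sum.inl e => dist_triangle b a c e
  | cons b _, Sum.inl a, Sum.inl c, Sum.inr e => by
    have := depth_le b c a; rw [dist_comm] at this; simp; omega
  | cons b _, Sum.inl a, Sum.inr c, Sum.inl e => by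
    have := dist_le_depth b a e; simp; omega
  | cons _ s, Sum.inl a, Sum.inr c, Sum.inr e => by
    have := depth_le s c e; simp; omega
  | cons b _, Sum.inr a, Sum.inl c, Sum.inl e => by
    have := depth_le b c e; simp; omega
  | cons _ s, Sum.inr a, Sum.inl c, Sum.inr e => by
    have := dist_le_depth s a e; simp; omega
  | cons _ s, Sum.inr a, Sum.inr c, Sum.inl e => by
    have := depth_le s c a; rw [dist_comm] at this; simp; omega
  | cons _ s, Sum.inr a, Sum.inr c, Sum.inr e => dist_triangle s a c e

end basic

/-! ### Good placements and invariance under isomorphism -/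

/-- `f` is a good 2-placement of `t`, with all vertices moved by at most four. -/
structure GoodMap (t : RTree) (f : t.Vert → t.Vert) : Prop where
  inj : Function.Injective f
  ne : ∀ a, f a ≠ a
  edge : ∀ a c, t.dist a c = 1 → t.dist (f a) (f c) ≠ 1 ∧ t.dist (f a) (f c) ≤ 5
  base : t.dist t.root (f t.root) = 1
  nbr : ∀ a, t.dist t.root a = 1 → t.dist a (f a) ≤ 2
  le_four : ∀ a, t.dist a (f a) ≤ 4

/-- The tree has a good 2-placement. -/
def Good (t : RTree) : Prop := ∃ f, t.GoodMap f

/-- Isomorphism of rooted trees. -/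
def Iso (s t : RTree) : Prop :=
  ∃ e : s.Vert ≃ t.Vert, (∀ a c, t.dist (e a) (e c) = s.dist a c) ∧ e s.root = t.root

namespace Iso

lemma refl (t : RTree) : Iso t t := ⟨Equiv.refl _, fun _ _ => rfl, rfl⟩

lemma symm {s t : RTree} : Iso s t → Iso t s := by
  rintro ⟨e, h, hr⟩
  refine ⟨e.symm, fun a c => ?_, ?_⟩
  · rw [← h]; simp
  · rw [← hr]; simp

lemma trans {s t u : RTree} : Iso s t → Iso t u → Iso s u := by
  rintro ⟨e, h, hr⟩ ⟨e', h', hr'⟩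
  exact ⟨e.trans e', fun a c => by simp [h, h'], by simp [hr, hr']⟩

lemma depth_eq {s t : RTree} {e : s.Vert ≃ t.Vert}
    (h : ∀ a c, t.dist (e a) (e c) = s.dist a c) (hr : e s.root = t.root) (a : s.Vert) :
    t.depth (e a) = s.depth a := by
  rw [← dist_root, ← hr, h, dist_root]

lemma cons {b b' s s' : RTree} : Iso b b' → Iso s s' → Iso (b.cons s) (b'.cons s') := by
  rintro ⟨e, h, hr⟩ ⟨e', h', hr'⟩
  refine ⟨Equiv.sumCongr e e', ?_, congrArg Sum.inr hr'⟩
  rintro (a | a) (c | c)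
  · exact h a c
  · exact congrArg₂ (fun x y => x + 1 + y) (depth_eq h hr a) (depth_eq h' hr' c)
  · exact congrArg₂ (fun x y => x + 1 + y) (depth_eq h hr c) (depth_eq h' hr' a)
  · exact h' a c

lemma swap (b c s : RTree) : Iso (b.cons (c.cons s)) (c.cons (b.cons s)) := by
  refine ⟨(Equiv.sumAssoc _ _ _).symm.trans
    ((Equiv.sumCongr (Equiv.sumComm _ _) (Equiv.refl _)).trans (Equiv.sumAssoc _ _ _)), ?_, rfl⟩
  rintro (a | a | a) (e | e | e)
  · exact rfl
  · change c.depth e + 1 + (b.depth a + 1) = b.depth a + 1 + (c.depth e + 1)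
    omega
  · exact rfl
  · change c.depth a + 1 + (b.depth e + 1) = b.depth e + 1 + (c.depth a + 1)
    omega
  · exact rfl
  · exact rfl
  · exact rfl
  · exact rfl
  · exact rfl

lemma good {s t : RTree} : Iso s t → s.Good → t.Good := by
  rintro ⟨e, h, hr⟩ ⟨f, hf⟩
  refine ⟨e ∘ f ∘ e.symm, ?_⟩
  have hr' : e.symm t.root = s.root := by rw [← hr]; simp
  have h' : ∀ a c, s.dist (e.symm a) (e.symm c) = t.dist a c := fun a c => by rw [← h]; simp
  have hf' : ∀ a c, t.dist a (e c) = s.dist (e.symm a) c := fun a c => by rw [← h]; simp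
  constructor
  · exact e.injective.comp (hf.inj.comp e.symm.injective)
  · intro a ha
    exact hf.ne (e.symm a) (e.injective (by simpa using ha))
  · intro a c hac
    simpa [h] using hf.edge (e.symm a) (e.symm c) (by rw [h', hac])
  · simpa [hf', hr'] using hf.base
  · intro a ha
    simpa [hf'] using hf.nbr (e.symm a) (by rw [← hr', h', ha])
  · intro a
    simpa [hf'] using hf.le_four (e.symm a)

end Iso

/-- The list of the subtrees at the children of the root. -/
def kids : RTree → List RTree
  | nil => []
  | cons b s => b :: kids s

/-- The rooted tree with the given list of subtrees at the children of the root. -/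
def ofKids : List RTree → RTree
  | [] => nil
  | b :: l => cons b (ofKids l)

@[simp] lemma ofKids_nil : ofKids [] = nil := rfl
@[simp] lemma ofKids_cons (b : RTree) (l : List RTree) : ofKids (b :: l) = cons b (ofKids l) := rfl
@[simp] lemma kids_nil : kids nil = [] := rfl
@[simp] lemma kids_cons (b s : RTree) : kids (cons b s) = b :: kids s := rfl

@[simp] lemma ofKids_kids : (t : RTree) → ofKids t.kids = t
  | nil => rfl
  | cons b s => congrArg (cons b) (ofKids_kids s)

@[simp] lemma kids_ofKids : (l : List RTree) → kids (ofKids l) = l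
  | [] => rfl
  | b :: l => congrArg (b :: ·) (kids_ofKids l)

lemma iso_ofKids {l l' : List RTree} (h : l.Perm l') : Iso (ofKids l) (ofKids l') := by
  induction h with
  | nil => exact Iso.refl _
  | cons b _ ih => exact (Iso.refl b).cons ih
  | swap b c l => exact Iso.swap c b _
  | trans _ _ ih ih' => exact ih.trans ih'

lemma size_ofKids (l : List RTree) : (ofKids l).size = (l.map size).sum + 1 := by
  induction l with
  | nil => rfl
  | cons b l ih => simp [ih]; omega

lemma size_eq (t : RTree) : t.size = (t.kids.map size).sum + 1 := by
  rw [← size_ofKids, ofKids_kids]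

/-! ### Gluing branches at the root or at a child of the root -/

/-- `f` places the branch or pair of branches `W` attached to a common vertex, where `h` is the
distance from that vertex. -/
structure BranchMap {W : Type} (d : W → W → ℕ) (h : W → ℕ) (f : W → W) : Prop where
  inj : Function.Injective f
  ne : ∀ a, f a ≠ a
  pos : ∀ a, 0 < h a
  edge : ∀ a c, d a c = 1 → d (f a) (f c) ≠ 1 ∧ d (f a) (f c) ≤ 5
  depth_le : ∀ a, h a = 1 → h (f a) ≤ 3
  nbr : ∀ a, h a = 1 → d a (f a) ≤ 2
  le_four : ∀ a, d a (f a) ≤ 4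

/-- Branches can be attached to the root or to a child of the root. -/
lemma good_of_branchMap {s t : RTree} {W : Type} {d : W → W → ℕ} {h : W → ℕ} {g : W → W}
    (hg : BranchMap d h g) (hs : s.Good) (p : s.Vert) (hp : s.depth p ≤ 1)
    (e : s.Vert ⊕ W ≃ t.Vert) (hr : e (Sum.inl s.root) = t.root)
    (h1 : ∀ a c, t.dist (e (Sum.inl a)) (e (Sum.inl c)) = s.dist a c)
    (h2 : ∀ a w, t.dist (e (Sum.inl a)) (e (Sum.inr w)) = s.dist a p + h w)
    (h3 : ∀ w w', t.dist (e (Sum.inr w)) (e (Sum.inr w')) = d w w') : t.Good := by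
  obtain ⟨f, hf⟩ := hs
  have hp2 : s.dist p (f p) ≤ 2 := by
    rcases Nat.le_one_iff_eq_zero_or_eq_one.1 hp with h0 | h0
    · rw [eq_root_of_depth s p h0, hf.base]; norm_num
    · exact hf.nbr p (by rwa [dist_root])
  have hp0 : 0 < s.dist (f p) p := s.dist_pos (hf.ne p)
  have hp2' : s.dist (f p) p ≤ 2 := by rwa [dist_comm]
  -- The only edges between the two parts join `p` to a vertex with `h w = 1`. The image distance
  -- splits as a displacement of 1 or 2 plus a height between 1 and 3.
  have key : ∀ a w, s.dist a p + h w = 1 →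
      s.dist (f a) p + h (g w) ≠ 1 ∧ s.dist (f a) p + h (g w) ≤ 5 := by
    intro a w haw
    have hw := hg.pos w
    have hw' := hg.pos (g w)
    have ha : a = p := s.eq_of_dist _ _ (by omega)
    subst ha
    have := hg.depth_le w (by omega)
    omega
  refine ⟨fun x => e (Sum.map f g (e.symm x)), ?_⟩
  constructor
  · exact e.injective.comp ((hf.inj.sumMap hg.inj).comp e.symm.injective)
  · intro x hx
    obtain ⟨(a | a), rfl⟩ := e.surjective x
    · exact hf.ne a (by simpa using hx)
    · exact hg.ne a (by simpa using hx)
  · intro x y hxy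
    obtain ⟨(a | a), rfl⟩ := e.surjective x <;> obtain ⟨(c | c), rfl⟩ := e.surjective y
    · simpa [h1] using hf.edge a c (by rwa [h1] at hxy)
    · simpa [h2] using key a c (by rwa [h2] at hxy)
    · rw [dist_comm, h2] at hxy
      simpa [h2, dist_comm t (e (Sum.inr _)) (e (Sum.inl _))] using key c a hxy
    · simpa [h3] using hg.edge a c (by rwa [h3] at hxy)
  · rw [← hr]
    simpa [h1] using hf.base
  · intro x hx
    rw [← hr] at hx
    obtain ⟨(a | a), rfl⟩ := e.surjective x
    · simpa [h1] using hf.nbr a (by rwa [h1] at hx)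
    · rw [h2] at hx
      have := hg.pos a
      simpa [h3] using hg.nbr a (by omega)
  · intro x
    obtain ⟨(a | a), rfl⟩ := e.surjective x
    · simpa [h1] using hf.le_four a
    · simpa [h3] using hg.le_four a

/-- Distances in a pair of branches attached to a common vertex. -/
def pairDist (b c : RTree) : (cons b c).Vert → (cons b c).Vert → ℕ
  | Sum.inl a, Sum.inl a' => b.dist a a'
  | Sum.inl a, Sum.inr e => b.depth a + c.depth e + 2
  | Sum.inr e, Sum.inl a => b.depth a + c.depth e + 2
  | Sum.inr e, Sum.inr e' => c.dist e e'

/-- Distances in a pair of branches from the vertex to which they are attached. -/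
def pairDepth (b c : RTree) : (cons b c).Vert → ℕ
  | Sum.inl a => b.depth a + 1
  | Sum.inr e => c.depth e + 1

/-- A branch that can be attached to the root or to a child of the root. -/
def Attachable (b : RTree) : Prop := ∃ f, BranchMap b.dist (fun a => b.depth a + 1) f

/-- A pair of branches that can be attached to the root or to a child of the root. -/
def PairAttachable (b c : RTree) : Prop := ∃ f, BranchMap (pairDist b c) (pairDepth b c) f

lemma Good.attachable {b : RTree} : b.Good → b.Attachable := by
  rintro ⟨f, hf⟩
  refine ⟨f, hf.inj, hf.ne, fun _ => Nat.succ_pos _, hf.edge, ?_, ?_, hf.le_four⟩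
  · intro a ha
    rw [b.eq_root_of_depth a (by omega), ← dist_root, hf.base]; norm_num
  · intro a ha
    rw [b.eq_root_of_depth a (by omega), hf.base]; norm_num

lemma Attachable.root {b s : RTree} (hb : b.Attachable) (hs : s.Good) : (cons b s).Good := by
  obtain ⟨g, hg⟩ := hb
  refine good_of_branchMap hg hs s.root (by simp) (Equiv.sumComm _ _) rfl
    (fun _ _ => rfl) (fun a w => ?_) (fun _ _ => rfl)
  change b.depth w + 1 + s.depth a = _
  rw [dist_root']; omega

lemma PairAttachable.root {b c s : RTree} (hb : PairAttachable b c) (hs : s.Good) :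
    (cons b (cons c s)).Good := by
  obtain ⟨g, hg⟩ := hb
  refine good_of_branchMap hg hs s.root (by simp)
    ((Equiv.sumComm _ _).trans (Equiv.sumAssoc _ _ _)) rfl (fun _ _ => rfl) ?_ ?_
  · rintro a (w | w)
    · change b.depth w + 1 + s.depth a = s.dist a s.root + (b.depth w + 1)
      rw [dist_root']; omega
    · change c.depth w + 1 + s.depth a = s.dist a s.root + (c.depth w + 1)
      rw [dist_root']; omega
  · rintro (w | w) (w' | w')
    · exact rfl
    · change b.depth w + 1 + (c.depth w' + 1) = b.depth w + c.depth w' + 2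
      omega
    · change b.depth w' + 1 + (c.depth w + 1) = b.depth w' + c.depth w + 2
      omega
    · exact rfl

lemma Attachable.child {b v s : RTree} (hb : b.Attachable) (hs : (cons v s).Good) :
    (cons (cons b v) s).Good := by
  obtain ⟨g, hg⟩ := hb
  refine good_of_branchMap hg hs (Sum.inl v.root) (by simp)
    ((Equiv.sumComm _ _).trans (Equiv.sumAssoc _ _ _).symm) rfl ?_ ?_ (fun _ _ => rfl)
  · rintro (a | a) (a' | a')
    · exact rfl
    · exact rfl
    · exact rfl
    · exact rfl
  · rintro (a | a) w
    · change b.depth w + 1 + v.depth a = v.dist a v.root + (b.depth w + 1)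
      rw [dist_root']; omega
    · change b.depth w + 1 + 1 + s.depth a = v.depth v.root + 1 + s.depth a + (b.depth w + 1)
      rw [depth_root]; omega

lemma PairAttachable.child {b c v s : RTree} (hb : PairAttachable b c) (hs : (cons v s).Good) :
    (cons (cons b (cons c v)) s).Good := by
  obtain ⟨g, hg⟩ := hb
  refine good_of_branchMap hg hs (Sum.inl v.root) (by simp)
    ((Equiv.sumComm _ _).trans ((Equiv.sumAssoc _ _ _).symm.trans
      (Equiv.sumCongr (Equiv.sumAssoc _ _ _) (Equiv.refl _)))) rfl ?_ ?_ ?_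
  · rintro (a | a) (a' | a')
    · exact rfl
    · exact rfl
    · exact rfl
    · exact rfl
  · rintro (a | a) (w | w)
    · change b.depth w + 1 + v.depth a = v.dist a v.root + (b.depth w + 1)
      rw [dist_root']; omega
    · change c.depth w + 1 + v.depth a = v.dist a v.root + (c.depth w + 1)
      rw [dist_root']; omega
    · change b.depth w + 1 + 1 + s.depth a = v.depth v.root + 1 + s.depth a + (b.depth w + 1)
      rw [depth_root]; omega
    · change c.depth w + 1 + 1 + s.depth a = v.depth v.root + 1 + s.depth a + (c.depth w + 1)
      rw [depth_root]; omega
  · rintro (w | w) (w' | w')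
    · exact rfl
    · change b.depth w + 1 + (c.depth w' + 1) = b.depth w + c.depth w' + 2
      omega
    · change b.depth w' + 1 + (c.depth w + 1) = b.depth w' + c.depth w + 2
      omega
    · exact rfl

/-! ### Twin leaves -/

/-- `t` arises from `s` by adding a twin of the leaf `l`. -/
structure TwinAt (s t : RTree) (l : s.Vert) (e : Option s.Vert ≃ t.Vert) : Prop where
  old : ∀ a c, t.dist (e (some a)) (e (some c)) = s.dist a c
  twin : t.dist (e none) (e (some l)) = 2
  new : ∀ a, a ≠ l → t.dist (e none) (e (some a)) = s.dist l a
  root : e (some s.root) = t.root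
  leaf : ∃ p, s.dist l p = 1 ∧ ∀ a, s.dist l a = 1 → a = p

/-- A leaf and its twin are at the same distance from every other vertex. So the twin can take the
place of `l` as an image, while the twin itself is sent to `l`; images of old edges keep their
lengths. -/
lemma TwinAt.good {s t : RTree} {l : s.Vert} {e : Option s.Vert ≃ t.Vert} (h : TwinAt s t l e) :
    s.Good → t.Good := by
  classical
  rintro ⟨f, hf⟩
  obtain ⟨p, hlp, hp⟩ := h.leaf
  have new' : ∀ a, a ≠ l → t.dist (e (some a)) (e none) = s.dist l a := fun a ha => by
    rw [dist_comm, h.new a ha]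
  have twin' : t.dist (e (some l)) (e none) = 2 := by rw [dist_comm, h.twin]
  let F : Option s.Vert → Option s.Vert := fun o =>
    o.elim (some l) fun a => if f a = l then none else some (f a)
  have F0 : F none = some l := rfl
  have F1 : ∀ a, f a = l → F (some a) = none := fun a ha => by simp [F, ha]
  have F2 : ∀ a, f a ≠ l → F (some a) = some (f a) := fun a ha => by simp [F, ha]
  have hFd : ∀ a, t.dist (e (some a)) (e (F (some a))) = s.dist a (f a) := by
    intro a
    by_cases ha : f a = l
    · rw [F1 a ha, new' a (fun h => hf.ne a (by rw [ha, h])), ← ha, dist_comm]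
    · rw [F2 a ha, h.old]
  have hFe : ∀ a c, a ≠ c → t.dist (e (F (some a))) (e (F (some c))) = s.dist (f a) (f c) := by
    intro a c hac
    have hac' : f a ≠ f c := fun h => hac (hf.inj h)
    by_cases ha : f a = l
    · rw [F1 a ha, F2 c (fun h => hac' (ha.trans h.symm)),
        h.new _ (fun h => hac' (ha.trans h.symm)), ha]
    · by_cases hc : f c = l
      · rw [F1 c hc, F2 a ha, new' _ ha, ← hc, dist_comm]
      · rw [F2 a ha, F2 c hc, h.old]
  -- The edge from the twin to `p` goes to `l` and `f p`. These are not adjacent, because `p` is the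
  -- only neighbour of `l` and `f p ≠ p`; their distance is at most 1 + 4. If `f p = l`, the images
  -- are the two twins, at distance 2.
  have hFn : t.dist (e (F none)) (e (F (some p))) ≠ 1 ∧
      t.dist (e (F none)) (e (F (some p))) ≤ 5 := by
    by_cases hc : f p = l
    · rw [F0, F1 p hc, twin']; norm_num
    · rw [F0, F2 p hc, h.old]
      refine ⟨fun h1 => hf.ne p (hp _ h1), ?_⟩
      have := s.dist_triangle l p (f p)
      have := hf.le_four p
      omega
  have hnp : ∀ a, t.dist (e none) (e (some a)) = 1 → a = p := by
    intro a ha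
    by_cases hal : a = l
    · rw [hal, h.twin] at ha; omega
    · exact hp a (by rwa [h.new a hal] at ha)
  have hF : Function.Injective F := by
    rintro (_ | a) (_ | c) hac
    · rfl
    · by_cases hc : f c = l
      · rw [F0, F1 c hc] at hac; cases hac
      · rw [F0, F2 c hc] at hac; exact absurd (Option.some.inj hac).symm hc
    · by_cases hc : f a = l
      · rw [F0, F1 a hc] at hac; cases hac
      · rw [F0, F2 a hc] at hac; exact absurd (Option.some.inj hac) hc
    · by_contra hne
      have := hFe a c (fun h => hne (congrArg some h))
      rw [hac, dist_self] at this
      exact hne (congrArg some (hf.inj (s.eq_of_dist _ _ this.symm)))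
  refine ⟨fun x => e (F (e.symm x)), ?_⟩
  constructor
  · exact e.injective.comp (hF.comp e.symm.injective)
  · intro x hx
    obtain ⟨(_ | a), rfl⟩ := e.surjective x
    · simp [F0] at hx
    · have := hFd a
      simp only [Equiv.symm_apply_apply] at hx
      rw [hx, dist_self] at this
      exact hf.ne a (s.eq_of_dist _ _ this.symm).symm
  · intro x y hxy
    obtain ⟨(_ | a), rfl⟩ := e.surjective x <;> obtain ⟨(_ | c), rfl⟩ := e.surjective y <;>
      simp only [Equiv.symm_apply_apply]
    · simp at hxy
    · rw [hnp c hxy]; exact hFn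
    · rw [dist_comm] at hxy
      rw [hnp a hxy, dist_comm]; exact hFn
    · rw [h.old] at hxy
      rw [hFe a c (by rintro rfl; simp at hxy)]
      exact hf.edge a c hxy
  · rw [← h.root]
    simp only [Equiv.symm_apply_apply]
    rw [hFd, hf.base]
  · intro x hx
    rw [← h.root] at hx
    obtain ⟨(_ | a), rfl⟩ := e.surjective x <;> simp only [Equiv.symm_apply_apply]
    · rw [F0, h.twin]
    · rw [h.old] at hx
      rw [hFd]; exact hf.nbr a hx
  · intro x
    obtain ⟨(_ | a), rfl⟩ := e.surjective x <;> simp only [Equiv.symm_apply_apply]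
    · rw [F0, h.twin]; norm_num
    · rw [hFd]; exact hf.le_four a

lemma exists_leaf_child : (s : RTree) → nil ∈ s.kids →
    ∃ l : s.Vert, l ≠ s.root ∧ ∀ a, a ≠ l → s.dist l a = s.depth a + 1
  | nil, h => by simp at h
  | cons b s, h => by
    classical
    by_cases hb : b = nil
    · subst hb
      refine ⟨Sum.inl (), nofun, ?_⟩
      rintro (a | a) ha
      · exact absurd (congrArg Sum.inl (vert_nil_eq a ())) ha
      · change 0 + 1 + s.depth a = s.depth a + 1
        omega
    · obtain ⟨l, hl, h'⟩ := exists_leaf_child s (by simpa [Ne.symm hb] using h)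
      have hl1 : s.depth l = 1 := by simpa using h' s.root hl.symm
      refine ⟨Sum.inr l, fun h => hl (Sum.inr.inj h), ?_⟩
      rintro (a | a) ha
      · simp [hl1]
      · exact h' a (fun h => ha (congrArg Sum.inr h))

/-- `t` arises from `s` by adding, at some vertex with a leaf child, a further leaf child. -/
inductive AddTwin : RTree → RTree → Prop
  | here (s : RTree) : nil ∈ s.kids → AddTwin s (cons nil s)
  | left {b b' : RTree} (s : RTree) : AddTwin b b' → AddTwin (cons b s) (cons b' s)
  | right (b : RTree) {s s' : RTree} : AddTwin s s' → AddTwin (cons b s) (cons b s')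

lemma AddTwin.size_eq {s t : RTree} (h : AddTwin s t) : t.size = s.size + 1 := by
  induction h <;> simp [*] <;> omega

/-- The clause `l ≠ s.root` carries the induction: it gives the new leaf the depth of `l`, and it
keeps vertices outside the branch from being adjacent to `l`. -/
lemma AddTwin.exists_twinAt {s t : RTree} (h : AddTwin s t) :
    ∃ l e, l ≠ s.root ∧ TwinAt s t l e := by
  induction h with
  | here s hs =>
    obtain ⟨l, hl, h⟩ := exists_leaf_child s hs
    have hl1 : s.depth l = 1 := by simpa using h s.root hl.symm
    let e : Option s.Vert ≃ Unit ⊕ s.Vert :=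
      (Equiv.optionEquivSumPUnit _).trans (Equiv.sumComm _ _)
    refine ⟨l, e, hl, fun a c => rfl, ?_, fun a ha => ?_, rfl, s.root, by simpa using hl1, ?_⟩
    · change 0 + 1 + s.depth l = 2
      omega
    · rw [h a ha]
      change 0 + 1 + s.depth a = _
      omega
    · intro a ha
      by_cases hal : a = l
      · rw [hal, dist_self] at ha; omega
      · exact s.eq_root_of_depth a (by rw [h a hal] at ha; omega)
  | @left b b' s hb ih =>
    obtain ⟨l, e, hl, h⟩ := ih
    have hl0 := b.depth_pos hl
    have hd : ∀ a, b'.depth (e (some a)) = b.depth a := fun a => by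
      rw [← dist_root, ← h.root, h.old, dist_root]
    have hd0 : b'.depth (e none) = b.depth l := by
      rw [← dist_root', ← h.root, h.new _ hl.symm, dist_root']
    let E : Option (b.Vert ⊕ s.Vert) ≃ b'.Vert ⊕ s.Vert :=
      { toFun := fun o => o.elim (Sum.inl (e none)) (Sum.map (fun a => e (some a)) id)
        invFun := Sum.elim (fun x => (e.symm x).map Sum.inl) (fun c => some (Sum.inr c))
        left_inv := by rintro (_ | (a | c)) <;> simp
        right_inv := by
          rintro (x | c)
          · obtain ⟨(_ | a), rfl⟩ := e.surjective x <;> simp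
          · rfl }
    obtain ⟨p, hp, hp'⟩ := h.leaf
    refine ⟨Sum.inl l, E, nofun, ?_, h.twin, ?_, rfl, Sum.inl p, hp, ?_⟩
    · rintro (a | a) (c | c)
      · exact h.old a c
      · exact congrArg (fun x => x + 1 + s.depth c) (hd a)
      · exact congrArg (fun x => x + 1 + s.depth a) (hd c)
      · rfl
    · rintro (a | a) ha
      · exact h.new a (fun h => ha (congrArg Sum.inl h))
      · exact congrArg (fun x => x + 1 + s.depth a) hd0
    · rintro (a | a) ha
      · exact congrArg Sum.inl (hp' a ha)
      · simp at ha; omega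
  | @right b s s' hs ih =>
    obtain ⟨l, e, hl, h⟩ := ih
    have hl0 := s.depth_pos hl
    have hd : ∀ a, s'.depth (e (some a)) = s.depth a := fun a => by
      rw [← dist_root, ← h.root, h.old, dist_root]
    have hd0 : s'.depth (e none) = s.depth l := by
      rw [← dist_root', ← h.root, h.new _ hl.symm, dist_root']
    let E : Option (b.Vert ⊕ s.Vert) ≃ b.Vert ⊕ s'.Vert :=
      { toFun := fun o => o.elim (Sum.inr (e none)) (Sum.map id (fun a => e (some a)))
        invFun := Sum.elim (fun c => some (Sum.inl c)) (fun x => (e.symm x).map Sum.inr)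
        left_inv := by rintro (_ | (a | c)) <;> simp
        right_inv := by
          rintro (c | x)
          · rfl
          · obtain ⟨(_ | a), rfl⟩ := e.surjective x <;> simp }
    obtain ⟨p, hp, hp'⟩ := h.leaf
    refine ⟨Sum.inr l, E, fun h => hl (Sum.inr.inj h), ?_, h.twin, ?_, congrArg Sum.inr h.root,
      Sum.inr p, hp, ?_⟩
    · rintro (a | a) (c | c)
      · rfl
      · exact congrArg (fun x => b.depth a + 1 + x) (hd c)
      · exact congrArg (fun x => b.depth c + 1 + x) (hd a)
      · exact h.old a c
    · rintro (a | a) ha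
      · exact congrArg (fun x => b.depth a + 1 + x) hd0
      · exact h.new a (fun h => ha (congrArg Sum.inr h))
    · rintro (a | a) ha
      · simp at ha; omega
      · exact congrArg Sum.inr (hp' a ha)

lemma AddTwin.good {s t : RTree} (h : AddTwin s t) (hs : s.Good) : t.Good := by
  obtain ⟨l, e, -, h⟩ := h.exists_twinAt
  exact h.good hs

/-- Adding a twin of the root, when the root is a leaf. -/
lemma good_root_twin {v : RTree} (h : (cons v nil).Good) : (cons (cons nil v) nil).Good := by
  let E : Option (v.Vert ⊕ Unit) ≃ (Unit ⊕ v.Vert) ⊕ Unit :=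
    (Equiv.optionEquivSumPUnit _).trans
      ((Equiv.sumComm _ _).trans (Equiv.sumAssoc _ _ _).symm)
  -- Here the leaf being doubled is the root itself.
  refine TwinAt.good (s := cons v nil) (l := Sum.inr ()) (e := E) ?_ h
  refine ⟨?_, rfl, ?_, rfl, Sum.inl v.root, ?_, ?_⟩
  · rintro (a | a) (c | c)
    · rfl
    · rfl
    · rfl
    · rfl
  · rintro (a | a) ha
    · change 0 + 1 + v.depth a = v.depth a + 1 + 0
      omega
    · exact absurd rfl ha
  · change v.depth v.root + 1 + 0 = 1
    simp
  · rintro (a | a) ha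
    · change v.depth a + 1 + 0 = 1 at ha
      exact congrArg Sum.inl (v.eq_root_of_depth a (by omega))
    · cases ha

/-! ### Linking a branch to an exceptional remainder -/

/-- A map on a branch whose root `u` may be sent outside, provided that some outer vertex is sent
to `f u`. -/
structure ChainMap (b : RTree) (f : b.Vert → b.Vert) : Prop where
  inj : Function.Injective f
  ne : ∀ a, f a ≠ a
  edge : ∀ a c, a ≠ b.root → c ≠ b.root → b.dist a c = 1 →
    b.dist (f a) (f c) ≠ 1 ∧ b.dist (f a) (f c) ≤ 5
  base : b.depth (f b.root) = 1
  depth_le : ∀ a, b.depth a = 1 → b.depth (f a) ≤ 3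
  le_four : ∀ a, b.dist a (f a) ≤ 4

lemma GoodMap.chainMap {b : RTree} {f : b.Vert → b.Vert} (hf : b.GoodMap f) : b.ChainMap f := by
  refine ⟨hf.inj, hf.ne, fun a c _ _ => hf.edge a c, by simpa using hf.base, fun a ha => ?_,
    hf.le_four⟩
  have := b.depth_le a (f a)
  have := hf.nbr a (by simpa using ha)
  omega

/-- The tree has a map as in `ChainMap`. -/
def Chainable (b : RTree) : Prop := ∃ f, b.ChainMap f

/-- Distances between the vertices of a tree `s` and a child `none` of the new child of its
vertex `p`. -/
def hangDist (s : RTree) (p : s.Vert) : Option s.Vert → Option s.Vert → ℕ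
  | some a, some c => s.dist a c
  | some a, none => s.dist a p + 2
  | none, some a => s.dist a p + 2
  | none, none => 0

/-- The conditions under which `q` can be combined with a `ChainMap` of a branch hanging from `p`:
the root of the branch is sent to `i`, and `none` stands for the image of this root under the
`ChainMap`. -/
structure HostMap (s : RTree) (p i : s.Vert) (q : s.Vert → Option s.Vert) : Prop where
  inj : Function.Injective q
  ne_some : ∀ a, q a ≠ some a
  ne_first : ∀ a, q a ≠ some i
  edge : ∀ a c, s.dist a c = 1 →
    s.hangDist p (q a) (q c) ≠ 1 ∧ s.hangDist p (q a) (q c) ≤ 5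
  edge_first : s.hangDist p (some i) (q p) ≠ 1 ∧ s.hangDist p (some i) (q p) ≤ 5
  first : s.dist i p = 1
  base : s.hangDist p (some s.root) (q s.root) = 1
  nbr : ∀ a, s.dist s.root a = 1 → s.hangDist p (some a) (q a) ≤ 2
  le_four : ∀ a, s.hangDist p (some a) (q a) ≤ 4

/-- Splices the two maps: the root of the branch goes to `i`, and its abandoned image `f b.root` is
taken by the vertex that `q` sends to `none`. Since `f b.root` is a child of the branch root, it
lies at distance 2 from `p`, so distances between images of vertices of `s` are exactly those of
`hangDist`. -/
lemma ChainMap.good {b s t : RTree} {f : b.Vert → b.Vert} (hf : b.ChainMap f)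
    {p i : s.Vert} {q : s.Vert → Option s.Vert} (hq : s.HostMap p i q)
    (e : b.Vert ⊕ s.Vert ≃ t.Vert) (hr : e (Sum.inr s.root) = t.root)
    (h1 : ∀ a c, t.dist (e (Sum.inl a)) (e (Sum.inl c)) = b.dist a c)
    (h2 : ∀ a w, t.dist (e (Sum.inl a)) (e (Sum.inr w)) = b.depth a + 1 + s.dist w p)
    (h3 : ∀ w w', t.dist (e (Sum.inr w)) (e (Sum.inr w')) = s.dist w w') : t.Good := by
  have h2' : ∀ a w, t.dist (e (Sum.inr w)) (e (Sum.inl a)) = b.depth a + 1 + s.dist w p :=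
    fun a w => by rw [dist_comm, h2]
  let j : Option s.Vert → b.Vert ⊕ s.Vert := fun o => o.elim (Sum.inl (f b.root)) Sum.inr
  have hj : Function.Injective j := by
    rintro (_ | a) (_ | c) hac
    · rfl
    · cases hac
    · cases hac
    · exact congrArg some (Sum.inr.inj hac)
  have hjd : ∀ o o', t.dist (e (j o)) (e (j o')) = s.hangDist p o o' := by
    rintro (_ | a) (_ | c)
    · exact dist_self _ _
    · change t.dist (e (Sum.inl (f b.root))) (e (Sum.inr c)) = s.dist c p + 2
      rw [h2, hf.base]; omega
    · change t.dist (e (Sum.inr a)) (e (Sum.inl (f b.root))) = s.dist a p + 2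
      rw [h2', hf.base]; omega
    · exact h3 a c
  have hji : ∀ a, j (some a) = Sum.inr a := fun _ => rfl
  have hjl : ∀ o a, t.dist (e (Sum.inl a)) (e (j o)) = 1 → a ≠ b.root → o = none := by
    rintro (_ | c) a h ha
    · rfl
    · have := b.depth_pos ha
      rw [hji, h2] at h
      omega
  let F : b.Vert ⊕ s.Vert → b.Vert ⊕ s.Vert :=
    Sum.elim (fun a => if a = b.root then Sum.inr i else Sum.inl (f a)) (fun w => j (q w))
  have Fr : F (Sum.inl b.root) = j (some i) := if_pos rfl
  have Fn : ∀ a, a ≠ b.root → F (Sum.inl a) = Sum.inl (f a) := fun a ha => if_neg ha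
  have Fs : ∀ w, F (Sum.inr w) = j (q w) := fun _ => rfl
  have hFj : ∀ a, a ≠ b.root → ∀ o, F (Sum.inl a) ≠ j o := by
    rintro a ha (_ | c) h
    · rw [Fn a ha] at h
      exact ha (hf.inj (Sum.inl.inj h))
    · rw [Fn a ha] at h
      cases h
  have hF : Function.Injective F := by
    rintro (a | a) (c | c) hac
    · by_cases ha : a = b.root <;> by_cases hc : c = b.root
      · rw [ha, hc]
      · rw [ha, Fr] at hac; exact absurd hac.symm (hFj c hc _)
      · rw [hc, Fr] at hac; exact absurd hac (hFj a ha _)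
      · rw [Fn a ha, Fn c hc] at hac
        rw [hf.inj (Sum.inl.inj hac)]
    · by_cases ha : a = b.root
      · rw [ha, Fr, Fs] at hac; exact absurd (hj hac).symm (hq.ne_first c)
      · exact absurd hac (hFj a ha _)
    · by_cases hc : c = b.root
      · rw [hc, Fr, Fs] at hac; exact absurd (hj hac) (hq.ne_first a)
      · exact absurd hac.symm (hFj c hc _)
    · exact congrArg Sum.inr (hq.inj (hj hac))
  -- These edges lie within the branch but are sent across `p`: the image distance is 1 (from `i` to
  -- `p`) plus 1 plus a depth of at most 3. Hence `ChainMap` asks nothing else of edges at its root.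
  have hroot : ∀ c, b.dist b.root c = 1 →
      t.dist (e (F (Sum.inl b.root))) (e (F (Sum.inl c))) ≠ 1 ∧
        t.dist (e (F (Sum.inl b.root))) (e (F (Sum.inl c))) ≤ 5 := by
    intro c hc
    rw [dist_root] at hc
    have hcr : c ≠ b.root := fun h => by rw [h, depth_root] at hc; omega
    have := hf.depth_le c hc
    rw [Fr, Fn c hcr, hji, h2', hq.first]
    omega
  have hmix : ∀ a w, t.dist (e (Sum.inl a)) (e (Sum.inr w)) = 1 →
      t.dist (e (F (Sum.inl a))) (e (F (Sum.inr w))) ≠ 1 ∧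
        t.dist (e (F (Sum.inl a))) (e (F (Sum.inr w))) ≤ 5 := by
    intro a w h
    rw [h2] at h
    rw [b.eq_root_of_depth a (by omega), s.eq_of_dist w p (by omega), Fr, Fs, hjd]
    exact hq.edge_first
  refine ⟨fun x => e (F (e.symm x)), ?_⟩
  constructor
  · exact e.injective.comp (hF.comp e.symm.injective)
  · intro x hx
    obtain ⟨(a | a), rfl⟩ := e.surjective x <;> simp only [Equiv.symm_apply_apply] at hx <;>
      have hx := e.injective hx
    · by_cases ha : a = b.root
      · rw [ha, Fr] at hx; cases hx
      · rw [Fn a ha] at hx; exact hf.ne a (Sum.inl.inj hx)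
    · exact hq.ne_some a (hj hx)
  · intro x y hxy
    obtain ⟨(a | a), rfl⟩ := e.surjective x <;> obtain ⟨(c | c), rfl⟩ := e.surjective y <;>
      simp only [Equiv.symm_apply_apply]
    · rw [h1] at hxy
      by_cases ha : a = b.root
      · subst ha; exact hroot c hxy
      · by_cases hc : c = b.root
        · subst hc
          rw [t.dist_comm]
          exact hroot a (by rwa [dist_comm])
        · rw [Fn a ha, Fn c hc, h1]
          exact hf.edge a c ha hc hxy
    · exact hmix a c hxy
    · rw [t.dist_comm]
      exact hmix c a (by rwa [t.dist_comm])
    · rw [Fs, Fs, hjd]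
      exact hq.edge a c (by rwa [h3] at hxy)
  · rw [← hr, Equiv.symm_apply_apply, Fs, ← hji, hjd]
    exact hq.base
  · intro x hx
    rw [← hr] at hx
    obtain ⟨(a | a), rfl⟩ := e.surjective x <;> simp only [Equiv.symm_apply_apply]
    · rw [h2'] at hx
      rw [b.eq_root_of_depth a (by omega), Fr, hji, h2, hq.first, depth_root]
    · rw [h3] at hx
      rw [Fs, ← hji, hjd]
      exact hq.nbr a hx
  · intro x
    obtain ⟨(a | a), rfl⟩ := e.surjective x <;> simp only [Equiv.symm_apply_apply]
    · by_cases ha : a = b.root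
      · rw [ha, Fr, hji, h2, hq.first, depth_root]; norm_num
      · rw [Fn a ha, h1]
        exact hf.le_four a
    · rw [Fs, ← hji, hjd]
      exact hq.le_four a

lemma Chainable.good {b v s : RTree} (hb : b.Chainable) {i : (cons v s).Vert}
    {q : (cons v s).Vert → Option (cons v s).Vert}
    (hq : (cons v s).HostMap (Sum.inl v.root) i q) : (cons (cons b v) s).Good := by
  obtain ⟨f, hf⟩ := hb
  refine hf.good hq (Equiv.sumAssoc _ _ _).symm rfl (fun _ _ => rfl) ?_ ?_
  · rintro a (w | w)
    · change b.depth a + 1 + v.depth w = b.depth a + 1 + v.dist w v.root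
      rw [dist_root']
    · change b.depth a + 1 + 1 + s.depth w = b.depth a + 1 + (v.depth v.root + 1 + s.depth w)
      rw [depth_root]; omega
  · rintro (w | w) (w' | w')
    · rfl
    · rfl
    · rfl
    · rfl

/-! ### Explicit tables for small trees and branches -/

/-- The branch that is a path on two vertices. -/
abbrev K2 : RTree := cons nil nil

/-- The branch that is a path on three vertices, attached by an end. -/
abbrev P3 : RTree := cons (cons nil nil) nil

/-- The path on five vertices, rooted in the middle. -/
abbrev bad : RTree := cons K2 (cons K2 nil)

/-- The partial self-map of the vertices with a given table of values; values that are not places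
of vertices stand for `none`. -/
def ofPartialTable (t : RTree) (L : List ℕ) (a : t.Vert) : Option t.Vert :=
  if L.getD (t.index a) 0 < t.size then some (t.ofTable L a) else none

/-- The remainder is `K2`, a star. In the table, 2 is out of range and so means `none`: `p` goes
into the branch, the root goes to `p`, and the branch root goes to the root. -/
lemma Chainable.good_one {b : RTree} (hb : b.Chainable) : (cons (cons b nil) nil).Good :=
  hb.good (i := vertAt _ 1) (q := ofPartialTable _ [2, 0]) (by constructor <;> decide +kernel)

/-- The remainder is the star on three vertices rooted at its centre. -/
lemma Chainable.good_two {b : RTree} (hb : b.Chainable) : (cons (cons b nil) K2).Good :=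
  hb.good (i := vertAt _ 2) (q := ofPartialTable _ [3, 0, 1]) (by constructor <;> decide +kernel)

/-- The remainder is `bad`. The branch root is sent to the leaf below `p`, and `p` is sent into the
branch. -/
lemma Chainable.good_three {b : RTree} (hb : b.Chainable) :
    (cons (cons b K2) (cons K2 nil)).Good :=
  hb.good (i := vertAt _ 0) (q := ofPartialTable _ [3, 5, 4, 2, 1])
    (by constructor <;> decide +kernel)

/-- Attachment tolerates what `GoodMap` forbids: here the root goes to a leaf at depth 2, hence to
distance 3 from the vertex of attachment. -/
lemma attachable_bad : bad.Attachable :=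
  ⟨ofTable _ [1, 3, 4, 2, 0], by constructor <;> decide +kernel⟩

/-- The table swaps the root with one of its children, which is allowed because `ChainMap` ignores
edges at the root. -/
lemma chainable_bad : bad.Chainable :=
  ⟨ofTable _ [1, 2, 0, 4, 3], by constructor <;> decide +kernel⟩

lemma pairAttachable_nil_K2 : PairAttachable nil K2 :=
  ⟨ofTable (cons nil K2) [2, 0, 1], by constructor <;> decide +kernel⟩

lemma pairAttachable_nil_P3 : PairAttachable nil P3 :=
  ⟨ofTable (cons nil P3) [3, 2, 0, 1], by constructor <;> decide +kernel⟩

lemma pairAttachable_K2_K2 : PairAttachable K2 K2 :=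
  ⟨ofTable (cons K2 K2) [1, 3, 0, 2], by constructor <;> decide +kernel⟩

lemma pairAttachable_K2_P3 : PairAttachable K2 P3 :=
  ⟨ofTable (cons K2 P3) [1, 4, 3, 0, 2], by constructor <;> decide +kernel⟩

lemma pairAttachable_P3_P3 : PairAttachable P3 P3 :=
  ⟨ofTable (cons P3 P3) [1, 4, 0, 2, 5, 3], by constructor <;> decide +kernel⟩

/-! ### Trees whose branches are `nil`, `K2` and `P3` -/

/-- The list of `e` one-vertex branches, `a` branches `K2` and `k` branches `P3`. -/
def stdKids (e a k : ℕ) : List RTree :=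
  List.replicate e nil ++ (List.replicate a K2 ++ List.replicate k P3)

/-- The tree with the branches `stdKids e a k`. -/
def std (e a k : ℕ) : RTree := ofKids (stdKids e a k)

lemma stdKids_K2 (e a k : ℕ) : (K2 :: stdKids e a k).Perm (stdKids e (a + 1) k) :=
  List.perm_middle.symm

lemma stdKids_P3 (e a k : ℕ) : (P3 :: stdKids e a k).Perm (stdKids e a (k + 1)) := by
  refine List.perm_middle.symm.trans (List.Perm.append_left _ ?_)
  exact List.perm_middle.symm

lemma exists_perm_stdKids (l : List RTree) (h : ∀ b ∈ l, b = nil ∨ b = K2 ∨ b = P3) :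
    ∃ e a k, l.Perm (stdKids e a k) := by
  induction l with
  | nil => exact ⟨0, 0, 0, List.Perm.refl _⟩
  | cons b l ih =>
    obtain ⟨e, a, k, hl⟩ := ih fun c hc => h c (List.mem_cons_of_mem _ hc)
    rcases h b List.mem_cons_self with rfl | rfl | rfl
    · exact ⟨e + 1, a, k, hl.cons _⟩
    · exact ⟨e, a + 1, k, (hl.cons _).trans (stdKids_K2 e a k)⟩
    · exact ⟨e, a, k + 1, (hl.cons _).trans (stdKids_P3 e a k)⟩

/-- A property of rooted trees that is inherited when attachable pairs of branches are added at
the root. -/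
structure PairClosed (P : RTree → Prop) : Prop where
  iso : ∀ s t, Iso s t → P s → P t
  pair : ∀ b c s, PairAttachable b c → P s → P (cons b (cons c s))

lemma pairClosed_good : PairClosed Good :=
  ⟨fun _ _ h => h.good, fun _ _ _ h => h.root⟩

lemma pairClosed_cons (s : RTree) : PairClosed fun v => Good (cons v s) :=
  ⟨fun _ _ h => (h.cons (Iso.refl s)).good, fun _ _ _ h => h.child⟩

namespace PairClosed

variable {P : RTree → Prop}

lemma of_perm (hP : PairClosed P) {b c : RTree} (h : PairAttachable b c) {l l' : List RTree}
    (hl : (b :: c :: l).Perm l') (hs : P (ofKids l)) : P (ofKids l') :=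
  hP.iso _ _ (iso_ofKids hl) (hP.pair _ _ _ h hs)

lemma add_nil_K2 (hP : PairClosed P) {e a k : ℕ} (h : P (std e a k)) : P (std (e + 1) (a + 1) k) :=
  hP.of_perm pairAttachable_nil_K2 ((stdKids_K2 e a k).cons _) h

lemma add_nil_P3 (hP : PairClosed P) {e a k : ℕ} (h : P (std e a k)) : P (std (e + 1) a (k + 1)) :=
  hP.of_perm pairAttachable_nil_P3 ((stdKids_P3 e a k).cons _) h

lemma add_K2_K2 (hP : PairClosed P) {e a k : ℕ} (h : P (std e a k)) : P (std e (a + 2) k) :=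
  hP.of_perm pairAttachable_K2_K2 (((stdKids_K2 e a k).cons _).trans (stdKids_K2 e _ k)) h

lemma add_K2_P3 (hP : PairClosed P) {e a k : ℕ} (h : P (std e a k)) : P (std e (a + 1) (k + 1)) :=
  hP.of_perm pairAttachable_K2_P3 (((stdKids_P3 e a k).cons _).trans (stdKids_K2 e a _)) h

lemma add_P3_P3 (hP : PairClosed P) {e a k : ℕ} (h : P (std e a k)) : P (std e a (k + 2)) :=
  hP.of_perm pairAttachable_P3_P3 (((stdKids_P3 e a k).cons _).trans (stdKids_P3 e a _)) h

end PairClosed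

lemma good_std_001 : Good (std 0 0 1) :=
  ⟨ofTable _ [1, 3, 0, 2], by constructor <;> decide +kernel⟩

lemma good_std_002 : Good (std 0 0 2) :=
  ⟨ofTable _ [1, 4, 0, 6, 3, 2, 5], by constructor <;> decide +kernel⟩

lemma good_std_011 : Good (std 0 1 1) :=
  ⟨ofTable _ [3, 0, 5, 2, 1, 4], by constructor <;> decide +kernel⟩

lemma good_std_030 : Good (std 0 3 0) :=
  ⟨ofTable _ [2, 0, 1, 5, 6, 4, 3], by constructor <;> decide +kernel⟩

lemma good_std_040 : Good (std 0 4 0) :=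
  ⟨ofTable _ [1, 3, 4, 2, 0, 7, 8, 6, 5], by constructor <;> decide +kernel⟩

lemma good_std_101 : Good (std 1 0 1) :=
  ⟨ofTable _ [3, 2, 4, 1, 0], by constructor <;> decide +kernel⟩

lemma good_std_110 : Good (std 1 1 0) :=
  ⟨ofTable _ [2, 3, 1, 0], by constructor <;> decide +kernel⟩

lemma good_std_120 : Good (std 1 2 0) :=
  ⟨ofTable _ [2, 4, 1, 5, 3, 0], by constructor <;> decide +kernel⟩

lemma good_std_cons_nil_010 : Good (cons (std 0 1 0) nil) :=
  ⟨ofTable _ [1, 3, 0, 2], by constructor <;> decide +kernel⟩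

lemma good_std_cons_nil_001 : Good (cons (std 0 0 1) nil) :=
  ⟨ofTable _ [2, 0, 4, 1, 3], by constructor <;> decide +kernel⟩

lemma good_std_cons_nil_020 : Good (cons (std 0 2 0) nil) :=
  ⟨ofTable _ [1, 2, 3, 5, 0, 4], by constructor <;> decide +kernel⟩

lemma good_std_cons_nil_011 : Good (cons (std 0 1 1) nil) :=
  ⟨ofTable _ [1, 2, 4, 6, 3, 0, 5], by constructor <;> decide +kernel⟩

lemma good_std_cons_nil_002 : Good (cons (std 0 0 2) nil) :=
  ⟨ofTable _ [1, 5, 0, 2, 3, 7, 4, 6], by constructor <;> decide +kernel⟩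

lemma good_std_cons_K2_100 : Good (cons (std 1 0 0) K2) :=
  ⟨ofTable _ [3, 0, 1, 2], by constructor <;> decide +kernel⟩

lemma good_std_cons_K2_010 : Good (cons (std 0 1 0) K2) :=
  ⟨ofTable _ [1, 4, 0, 2, 3], by constructor <;> decide +kernel⟩

lemma good_std_cons_K2_001 : Good (cons (std 0 0 1) K2) :=
  ⟨ofTable _ [1, 5, 0, 2, 3, 4], by constructor <;> decide +kernel⟩

lemma good_std_cons_K2_110 : Good (cons (std 1 1 0) K2) :=
  ⟨ofTable _ [1, 2, 5, 0, 3, 4], by constructor <;> decide +kernel⟩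

lemma good_std_cons_K2_101 : Good (cons (std 1 0 1) K2) :=
  ⟨ofTable _ [1, 2, 0, 6, 3, 4, 5], by constructor <;> decide +kernel⟩

lemma good_std_cons_K2_020 : Good (cons (std 0 2 0) K2) :=
  ⟨ofTable _ [1, 2, 3, 6, 0, 4, 5], by constructor <;> decide +kernel⟩

lemma good_std_cons_K2_011 : Good (cons (std 0 1 1) K2) :=
  ⟨ofTable _ [1, 2, 3, 0, 7, 4, 5, 6], by constructor <;> decide +kernel⟩

lemma good_std_cons_K2_002 : Good (cons (std 0 0 2) K2) :=
  ⟨ofTable _ [1, 4, 0, 2, 3, 8, 5, 6, 7], by constructor <;> decide +kernel⟩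

lemma good_std_cons_P3_000 : Good (cons (std 0 0 0) P3) :=
  ⟨ofTable _ [2, 3, 1, 0], by constructor <;> decide +kernel⟩

lemma good_std_cons_P3_010 : Good (cons (std 0 1 0) P3) :=
  ⟨ofTable _ [1, 4, 0, 5, 3, 2], by constructor <;> decide +kernel⟩

lemma good_std_cons_P3_001 : Good (cons (std 0 0 1) P3) :=
  ⟨ofTable _ [1, 6, 0, 5, 2, 4, 3], by constructor <;> decide +kernel⟩

lemma good_bad_twin_left : Good (cons (cons nil K2) (cons K2 nil)) :=
  ⟨ofTable _ [1, 0, 4, 5, 3, 2], by constructor <;> decide +kernel⟩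

lemma good_bad_twin_right : Good (cons K2 (cons (cons nil K2) nil)) :=
  ⟨ofTable _ [5, 0, 3, 2, 1, 4], by constructor <;> decide +kernel⟩

/-- The hypotheses leave out exactly the stars `(0,0,0)`, `(1,0,0)`, `(0,1,0)` and the tree `bad`,
which is `(0,2,0)`. Pairs are removed so as never to reach one of these. -/
lemma good_std : ∀ e a k : ℕ, e ≤ 1 → 1 ≤ k ∨ 3 ≤ a ∨ (e = 1 ∧ 1 ≤ a) → Good (std e a k)
  | 0, 0, 0, _, h => by omega
  | 0, 0, 1, _, _ => good_std_001
  | 0, 0, 2, _, _ => good_std_002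
  | 0, 0, k + 3, _, _ => pairClosed_good.add_P3_P3 (good_std 0 0 (k + 1) (by omega) (by omega))
  | 0, 1, 0, _, h => by omega
  | 0, 1, 1, _, _ => good_std_011
  | 0, 1, k + 2, _, _ => pairClosed_good.add_K2_P3 (good_std 0 0 (k + 1) (by omega) (by omega))
  | 0, 2, 0, _, h => by omega
  | 0, 3, 0, _, _ => good_std_030
  | 0, 4, 0, _, _ => good_std_040
  | 0, a + 5, 0, _, _ => pairClosed_good.add_K2_K2 (good_std 0 (a + 3) 0 (by omega) (by omega))
  | 0, a + 2, k + 1, _, _ => pairClosed_good.add_K2_K2 (good_std 0 a (k + 1) (by omega) (by omega))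
  | 1, 0, 0, _, h => by omega
  | 1, 0, 1, _, _ => good_std_101
  | 1, 0, k + 2, _, _ => pairClosed_good.add_nil_P3 (good_std 0 0 (k + 1) (by omega) (by omega))
  | 1, 1, 0, _, _ => good_std_110
  | 1, 2, 0, _, _ => good_std_120
  | 1, a + 3, 0, _, _ => pairClosed_good.add_K2_K2 (good_std 1 (a + 1) 0 (by omega) (by omega))
  | 1, a + 1, k + 1, _, _ => pairClosed_good.add_nil_K2 (good_std 0 a (k + 1) (by omega) (by omega))
  | e + 2, _, _, h, _ => by omega

/-- No `nil` branch is needed here: such a leaf would be a twin of the root, which `good_root_twin`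
handles. -/
lemma good_std_cons_nil : ∀ a k : ℕ, 1 ≤ a + k → Good (cons (std 0 a k) nil)
  | 0, 0, h => by omega
  | 1, 0, _ => good_std_cons_nil_010
  | 2, 0, _ => good_std_cons_nil_020
  | a + 3, 0, _ => (pairClosed_cons nil).add_K2_K2 (good_std_cons_nil (a + 1) 0 (by omega))
  | 0, 1, _ => good_std_cons_nil_001
  | 0, 2, _ => good_std_cons_nil_002
  | 0, k + 3, _ => (pairClosed_cons nil).add_P3_P3 (good_std_cons_nil 0 (k + 1) (by omega))
  | 1, 1, _ => good_std_cons_nil_011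
  | 1, k + 2, _ => (pairClosed_cons nil).add_K2_P3 (good_std_cons_nil 0 (k + 1) (by omega))
  | a + 2, k + 1, _ => (pairClosed_cons nil).add_K2_K2 (good_std_cons_nil a (k + 1) (by omega))

lemma good_std_cons_K2 : ∀ e a k : ℕ, e ≤ 1 → 1 ≤ e + a + k → Good (cons (std e a k) K2)
  | 0, 0, 0, _, h => by omega
  | 0, 1, 0, _, _ => good_std_cons_K2_010
  | 0, 2, 0, _, _ => good_std_cons_K2_020
  | 0, a + 3, 0, _, _ =>
    (pairClosed_cons K2).add_K2_K2 (good_std_cons_K2 0 (a + 1) 0 (by omega) (by omega))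
  | 0, 0, 1, _, _ => good_std_cons_K2_001
  | 0, 0, 2, _, _ => good_std_cons_K2_002
  | 0, 0, k + 3, _, _ =>
    (pairClosed_cons K2).add_P3_P3 (good_std_cons_K2 0 0 (k + 1) (by omega) (by omega))
  | 0, 1, 1, _, _ => good_std_cons_K2_011
  | 0, 1, k + 2, _, _ =>
    (pairClosed_cons K2).add_K2_P3 (good_std_cons_K2 0 0 (k + 1) (by omega) (by omega))
  | 0, a + 2, k + 1, _, _ =>
    (pairClosed_cons K2).add_K2_K2 (good_std_cons_K2 0 a (k + 1) (by omega) (by omega))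
  | 1, 0, 0, _, _ => good_std_cons_K2_100
  | 1, 1, 0, _, _ => good_std_cons_K2_110
  | 1, 0, 1, _, _ => good_std_cons_K2_101
  | 1, 0, k + 2, _, _ =>
    (pairClosed_cons K2).add_nil_P3 (good_std_cons_K2 0 0 (k + 1) (by omega) (by omega))
  | 1, a + 2, 0, _, _ =>
    (pairClosed_cons K2).add_K2_K2 (good_std_cons_K2 1 a 0 (by omega) (by omega))
  | 1, a + 1, k + 1, _, _ =>
    (pairClosed_cons K2).add_nil_K2 (good_std_cons_K2 0 a (k + 1) (by omega) (by omega))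
  | e + 2, _, _, h, _ => by omega

/-- The left-out case `(1,0,0)` is `bad`, since `P3` is a root with the single branch `K2`. -/
lemma good_std_cons_P3 : ∀ e a k : ℕ, e ≤ 1 → e = 0 ∨ 1 ≤ a + k → Good (cons (std e a k) P3)
  | 0, 0, 0, _, _ => good_std_cons_P3_000
  | 0, 1, 0, _, _ => good_std_cons_P3_010
  | 0, 0, 1, _, _ => good_std_cons_P3_001
  | 0, 0, k + 2, _, _ =>
    (pairClosed_cons P3).add_P3_P3 (good_std_cons_P3 0 0 k (by omega) (by omega))
  | 0, 1, k + 1, _, _ =>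
    (pairClosed_cons P3).add_K2_P3 (good_std_cons_P3 0 0 k (by omega) (by omega))
  | 0, a + 2, k, _, _ =>
    (pairClosed_cons P3).add_K2_K2 (good_std_cons_P3 0 a k (by omega) (by omega))
  | 1, 0, 0, _, h => by omega
  | 1, a + 1, k, _, _ =>
    (pairClosed_cons P3).add_nil_K2 (good_std_cons_P3 0 a k (by omega) (by omega))
  | 1, 0, k + 1, _, _ =>
    (pairClosed_cons P3).add_nil_P3 (good_std_cons_P3 0 0 k (by omega) (by omega))
  | e + 2, _, _, h, _ => by omega

/-! ### Stars and reduced trees -/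

/-- All branches at the root are single vertices. -/
def AllNil (t : RTree) : Prop := ∀ b ∈ t.kids, b = nil

/-- The tree is a star, rooted at the centre or at a leaf. -/
def Star (t : RTree) : Prop := AllNil t ∨ ∃ c, t = cons c nil ∧ AllNil c

lemma not_addTwin_nil (t : RTree) : ¬ AddTwin nil t := by
  rintro ⟨⟩
  simp_all

lemma AddTwin.allNil {s t : RTree} (h : AddTwin s t) : AllNil s → AllNil t := by
  induction h with
  | here s _ =>
    intro hs b hb
    rcases List.mem_cons.1 hb with rfl | hb
    · rfl
    · exact hs b hb
  | left s hb _ =>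
    intro hs
    have := hs _ List.mem_cons_self
    subst this
    exact absurd hb (not_addTwin_nil _)
  | right b _ ih =>
    intro hs c hc
    rcases List.mem_cons.1 hc with rfl | hc
    · exact hs _ List.mem_cons_self
    · exact ih (fun c hc => hs c (List.mem_cons_of_mem _ hc)) c hc

/-- Used in contrapositive form: deleting a twin from a non-star leaves a non-star, to which the
induction hypothesis can apply. -/
lemma AddTwin.star {s t : RTree} (h : AddTwin s t) : Star s → Star t := by
  rintro (hs | ⟨c, rfl, hc⟩)
  · exact Or.inl (h.allNil hs)
  · cases h with
    | here _ h =>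
      obtain rfl : nil = c := by simpa using h
      exact Or.inl fun b hb => by simpa using hb
    | left _ h => exact Or.inr ⟨_, rfl, h.allNil hc⟩
    | right _ h => exact absurd h (not_addTwin_nil _)

lemma AddTwin.eq_of_K2 {t : RTree} (h : AddTwin K2 t) : t = cons nil K2 := by
  cases h with
  | here => rfl
  | left _ h => exact absurd h (not_addTwin_nil _)
  | right _ h => exact absurd h (not_addTwin_nil _)

lemma AddTwin.good_of_bad {t : RTree} (h : AddTwin bad t) : Good t := by
  cases h with
  | here _ h => simp at h
  | left _ h => rw [h.eq_of_K2]; exact good_bad_twin_left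
  | right _ h =>
    cases h with
    | here _ h => simp at h
    | left _ h => rw [h.eq_of_K2]; exact good_bad_twin_right
    | right _ h => exact absurd h (not_addTwin_nil _)

/-- No vertex has two leaf children. -/
def Reduced : RTree → Prop
  | nil => True
  | cons b s => Reduced b ∧ Reduced s ∧ (b = nil → nil ∉ s.kids)

lemma exists_addTwin : (t : RTree) → ¬ t.Reduced → ∃ s, AddTwin s t
  | nil, h => absurd trivial h
  | cons b s, h => by
    by_cases hb : b.Reduced
    · by_cases hs : s.Reduced
      · have : b = nil ∧ nil ∈ s.kids := by
          by_contra h'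
          exact h ⟨hb, hs, fun h1 h2 => h' ⟨h1, h2⟩⟩
        obtain ⟨rfl, h'⟩ := this
        exact ⟨s, AddTwin.here s h'⟩
      · obtain ⟨s', h'⟩ := exists_addTwin s hs
        exact ⟨_, AddTwin.right b h'⟩
    · obtain ⟨b', h'⟩ := exists_addTwin b hb
      exact ⟨_, AddTwin.left s h'⟩

lemma reduced_iff : (t : RTree) → (t.Reduced ↔
    (∀ b ∈ t.kids, b.Reduced) ∧ t.kids.Pairwise fun b c => ¬ (b = nil ∧ c = nil))
  | nil => by simp [Reduced]
  | cons b s => by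
    rw [Reduced, reduced_iff s, kids_cons, List.forall_mem_cons, List.pairwise_cons]
    have : (b = nil → nil ∉ s.kids) ↔ ∀ c ∈ s.kids, ¬ (b = nil ∧ c = nil) :=
      ⟨fun h c hc hbc => h hbc.1 (hbc.2 ▸ hc), fun h hb hs => h _ hs ⟨hb, rfl⟩⟩
    rw [this]
    tauto

lemma reduced_of_perm {l l' : List RTree} (h : l.Perm l') (hl : (ofKids l).Reduced) :
    (ofKids l').Reduced := by
  rw [reduced_iff, kids_ofKids] at hl ⊢
  exact ⟨fun b hb => hl.1 b (h.mem_iff.2 hb),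
    (h.pairwise_iff fun {_ _} h h' => h h'.symm).1 hl.2⟩

lemma Reduced.of_mem {t b : RTree} (ht : t.Reduced) (hb : b ∈ t.kids) : b.Reduced :=
  ((reduced_iff t).1 ht).1 b hb

lemma Reduced.eq_of_allNil {t : RTree} (ht : t.Reduced) (h : AllNil t) : t = nil ∨ t = K2 := by
  rcases t with _ | ⟨b, s⟩
  · exact Or.inl rfl
  · have hb : b = nil := h b List.mem_cons_self
    rcases s with _ | ⟨c, s⟩
    · exact Or.inr (by rw [hb])
    · have hc : c = nil := h c (List.mem_cons_of_mem _ List.mem_cons_self)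
      exact absurd (by simp [hc]) (ht.2.2 hb)

lemma Reduced.eq_of_star {t : RTree} (ht : t.Reduced) (h : Star t) :
    t = nil ∨ t = K2 ∨ t = P3 := by
  rcases h with h | ⟨c, rfl, hc⟩
  · rcases ht.eq_of_allNil h with h | h <;> simp [h]
  · rcases ht.1.eq_of_allNil hc with rfl | rfl <;> simp

lemma Reduced.le_one {e a k : ℕ} (h : (std e a k).Reduced) : e ≤ 1 := by
  rcases e with _ | _ | e
  · omega
  · omega
  · rw [std, reduced_iff, kids_ofKids] at h
    have := h.2
    simp [stdKids, List.replicate_succ] at this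

lemma exists_std {t : RTree} (ht : t.Reduced) (h : ∀ b ∈ t.kids, Star b) :
    ∃ e a k, e ≤ 1 ∧ t.kids.Perm (stdKids e a k) := by
  obtain ⟨e, a, k, hp⟩ := exists_perm_stdKids t.kids fun b hb => (ht.of_mem hb).eq_of_star (h b hb)
  refine ⟨e, a, k, Reduced.le_one (reduced_of_perm hp (by simpa using ht)), hp⟩

lemma star_ofKids_of_perm {l l' : List RTree} (h : l.Perm l') (hl : Star (ofKids l)) :
    Star (ofKids l') := by
  rcases hl with hl | ⟨c, hc, hc'⟩
  · refine Or.inl fun b hb => hl b ?_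
    rw [kids_ofKids] at hb ⊢
    exact h.mem_iff.2 hb
  · have := congrArg kids hc
    rw [kids_ofKids] at this
    subst this
    rw [kids_cons, kids_nil] at h
    rw [← List.singleton_perm.1 h]
    exact Or.inr ⟨c, rfl, hc'⟩

lemma eq_bad_of_perm {t : RTree} (h : t.kids.Perm [K2, K2]) : t = bad := by
  have := List.perm_replicate (n := 2).1 h
  rw [← ofKids_kids t, this]
  rfl

/-- A tree with a branch that is not a star is isomorphic to one with this branch in front. -/
lemma exists_perm_of_not_star {t : RTree} (h : ¬ ∀ b ∈ t.kids, Star b) :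
    ∃ b s, ¬ Star b ∧ t.kids.Perm (kids (cons b s)) := by
  push Not at h
  obtain ⟨b, hb, hs⟩ := h
  obtain ⟨l₁, l₂, hl⟩ := List.append_of_mem hb
  refine ⟨b, ofKids (l₁ ++ l₂), hs, ?_⟩
  rw [hl, kids_cons, kids_ofKids]
  exact List.perm_middle

lemma iso_of_perm {s t : RTree} (h : s.kids.Perm t.kids) : Iso s t := by
  simpa using iso_ofKids h

lemma size_eq_of_perm {s t : RTree} (h : s.kids.Perm t.kids) : s.size = t.size := by
  rw [size_eq s, size_eq t, (h.map size).sum_eq]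

lemma reduced_of_kids_perm {s t : RTree} (h : s.kids.Perm t.kids) (hs : s.Reduced) :
    t.Reduced := by
  have := reduced_of_perm h (by simpa using hs)
  simpa using this

lemma star_of_perm {s t : RTree} (h : s.kids.Perm t.kids) (hs : Star s) : Star t := by
  have := star_ofKids_of_perm h (by simpa using hs)
  simpa using this

lemma good_of_iso_child {v v' s : RTree} (h : Iso v v') (hg : (cons v' s).Good) :
    (cons v s).Good := (h.symm.cons (Iso.refl s)).good hg

lemma Reduced.eq_nil_of_star_cons {v : RTree} (hv : nil ∉ v.kids) (h : Star (cons v nil)) :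
    v = nil := by
  have key : AllNil v → v = nil := by
    rcases v with _ | ⟨b, s⟩
    · exact fun _ => rfl
    · intro h
      exact absurd (by simp [h b List.mem_cons_self]) hv
  rcases h with h | ⟨c, hc, h⟩
  · exact h v List.mem_cons_self
  · cases hc
    exact key h

lemma eq_nil_of_star_cons_K2 {v : RTree} (h : Star (cons v K2)) : v = nil := by
  rcases h with h | ⟨c, hc, h⟩
  · exact h v List.mem_cons_self
  · cases hc

lemma not_star_cons_P3 {v : RTree} : ¬ Star (cons v P3) := by
  rintro (h | ⟨c, hc, h⟩)
  · have := h K2 (by simp)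
    cases this
  · cases hc

/-! ### The induction -/

/-- All trees with fewer than `n` vertices that are not excluded have a good 2-placement. -/
def GoodBelow (n : ℕ) : Prop := ∀ s : RTree, s.size < n → ¬ Star s → s ≠ bad → Good s

lemma attachable_of_not_star {n : ℕ} (ih : GoodBelow n) (b : RTree) (hb : ¬ Star b)
    (h : b.size < n) : b.Attachable := by
  by_cases hbad : b = bad
  · rw [hbad]; exact attachable_bad
  · exact (ih b h hb hbad).attachable

lemma chainable_of_not_star {n : ℕ} (ih : GoodBelow n) (b : RTree) (hb : ¬ Star b)
    (h : b.size < n) : b.Chainable := by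
  by_cases hbad : b = bad
  · rw [hbad]; exact chainable_bad
  · obtain ⟨f, hf⟩ := ih b h hb hbad
    exact ⟨f, hf.chainMap⟩

/-- The rest of a tree is a star, so that it is attached to a single large branch `b`. -/
lemma good_cons_nil {n : ℕ} (ih : GoodBelow n) (b : RTree) (hr : b.Reduced)
    (hb : ¬ Star b) (hn : (cons b nil).size = n) : (cons b nil).Good := by
  by_cases h0 : nil ∈ b.kids
  · obtain ⟨v, hp⟩ : ∃ v, b.kids.Perm (kids (cons nil v)) := by
      obtain ⟨l₁, l₂, hl⟩ := List.append_of_mem h0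
      refine ⟨ofKids (l₁ ++ l₂), ?_⟩
      rw [hl, kids_cons, kids_ofKids]
      exact List.perm_middle
    -- The root is a leaf whose neighbour has another leaf; that leaf is deleted as a twin of the
    -- root.
    refine good_of_iso_child (iso_of_perm hp) (good_root_twin (ih _ ?_ ?_ ?_))
    · rw [← hn, size_cons, size_cons, size_eq_of_perm hp, size_cons, size_nil]; omega
    · intro hs
      refine hb (star_of_perm hp.symm (Or.inl fun c hc => ?_))
      rcases List.mem_cons.1 hc with rfl | hc
      · rfl
      · rcases hs with hs | ⟨c', hc', hs⟩
        · have : v = nil := hs v List.mem_cons_self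
          rw [this] at hc; simp at hc
        · cases hc'
          exact hs c hc
    · intro h; cases h
  · by_cases hs : ∀ c ∈ b.kids, Star c
    · obtain ⟨e, a, k, he, hp⟩ := exists_std hr hs
      have he0 : e = 0 := by
        by_contra h
        obtain rfl : e = 1 := by omega
        exact h0 (hp.mem_iff.2 (by simp [stdKids]))
      subst he0
      have hp' : b.kids.Perm (std 0 a k).kids := by rwa [std, kids_ofKids]
      refine good_of_iso_child (iso_of_perm hp') (good_std_cons_nil a k ?_)
      by_contra h
      obtain ⟨rfl, rfl⟩ : a = 0 ∧ k = 0 := by omega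
      exact hb (star_of_perm hp'.symm (Or.inl fun c hc => by simp [std, stdKids] at hc))
    · obtain ⟨c, v, hc, hp⟩ := exists_perm_of_not_star hs
      refine good_of_iso_child (iso_of_perm hp) ?_
      have hsz := size_eq_of_perm hp
      have hv := size_pos v
      have hc' := size_pos c
      rw [size_cons, size_nil] at hn
      rw [size_cons] at hsz
      -- Detaching `c` leaves a star only if `v = nil`, because leaf children of the root's
      -- neighbour were dealt with above.
      by_cases hv0 : v = nil
      · subst hv0
        exact (chainable_of_not_star ih c hc (by omega)).good_one
      · refine (attachable_of_not_star ih c hc (by omega)).child (ih _ ?_ ?_ ?_)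
        · rw [size_cons, size_nil]; omega
        · intro h
          refine hv0 (Reduced.eq_nil_of_star_cons (fun h' => h0 ?_) h)
          exact hp.mem_iff.2 (List.mem_cons_of_mem _ h')
        · intro h; cases h

lemma good_cons_K2 {n : ℕ} (ih : GoodBelow n) (b : RTree) (hr : b.Reduced)
    (hb : ¬ Star b) (hn : (cons b K2).size = n) : (cons b K2).Good := by
  by_cases hs : ∀ c ∈ b.kids, Star c
  · obtain ⟨e, a, k, he, hp⟩ := exists_std hr hs
    have hp' : b.kids.Perm (std e a k).kids := by rwa [std, kids_ofKids]
    refine good_of_iso_child (iso_of_perm hp') (good_std_cons_K2 e a k he ?_)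
    by_contra h
    obtain ⟨rfl, rfl, rfl⟩ : e = 0 ∧ a = 0 ∧ k = 0 := by omega
    exact hb (star_of_perm hp'.symm (Or.inl fun c hc => by simp [std, stdKids] at hc))
  · obtain ⟨c, v, hc, hp⟩ := exists_perm_of_not_star hs
    refine good_of_iso_child (iso_of_perm hp) ?_
    have hsz := size_eq_of_perm hp
    have hv := size_pos v
    have hc' := size_pos c
    rw [size_cons] at hn hsz
    by_cases hv0 : v = nil
    · subst hv0
      exact (chainable_of_not_star ih c hc (by omega)).good_two
    · refine (attachable_of_not_star ih c hc (by omega)).child (ih _ ?_ ?_ ?_)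
      · rw [size_cons]; omega
      · exact fun h => hv0 (eq_nil_of_star_cons_K2 h)
      · intro h; cases h

lemma good_cons_P3 {n : ℕ} (ih : GoodBelow n) (b : RTree) (hr : b.Reduced)
    (hb : ¬ Star b) (hn : (cons b P3).size = n) : (cons b P3).Good := by
  by_cases hs : ∀ c ∈ b.kids, Star c
  · obtain ⟨e, a, k, he, hp⟩ := exists_std hr hs
    have hp' : b.kids.Perm (std e a k).kids := by rwa [std, kids_ofKids]
    refine good_of_iso_child (iso_of_perm hp') (good_std_cons_P3 e a k he ?_)
    by_contra h
    obtain ⟨rfl, rfl, rfl⟩ : e = 1 ∧ a = 0 ∧ k = 0 := by omega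
    exact hb (star_of_perm hp'.symm (Or.inl fun c hc => by simpa [std, stdKids] using hc))
  · obtain ⟨c, v, hc, hp⟩ := exists_perm_of_not_star hs
    refine good_of_iso_child (iso_of_perm hp) ?_
    have hsz := size_eq_of_perm hp
    have hv := size_pos v
    have hc' := size_pos c
    rw [size_cons] at hn hsz
    -- Detaching `c` leaves `cons K2 P3`, which is `bad`, exactly in this case.
    by_cases hv0 : v = K2
    · subst hv0
      exact (chainable_of_not_star ih c hc (by omega)).good_three
    · refine (attachable_of_not_star ih c hc (by omega)).child (ih _ ?_ ?_ ?_)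
      · rw [size_cons]; omega
      · exact not_star_cons_P3
      · intro h; cases h; exact hv0 rfl

lemma good_step {n : ℕ} (ih : GoodBelow n) (t : RTree) (hn : t.size = n)
    (hstar : ¬ Star t) (hbad : t ≠ bad) : Good t := by
  by_cases hr : t.Reduced
  swap
  · obtain ⟨s, hs⟩ := exists_addTwin t hr
    by_cases hsb : s = bad
    · subst hsb; exact hs.good_of_bad
    · exact hs.good (ih s (by rw [← hn, hs.size_eq]; omega) (fun h => hstar (hs.star h)) hsb)
  by_cases hs : ∀ b ∈ t.kids, Star b
  · obtain ⟨e, a, k, he, hp⟩ := exists_std hr hs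
    have hp' : t.kids.Perm (std e a k).kids := by rwa [std, kids_ofKids]
    refine (iso_of_perm hp').symm.good (good_std e a k he ?_)
    by_contra h
    have hcase : k = 0 ∧ a = 0 ∨ k = 0 ∧ a = 1 ∧ e = 0 ∨ k = 0 ∧ a = 2 ∧ e = 0 := by omega
    rcases hcase with ⟨rfl, rfl⟩ | ⟨rfl, rfl, rfl⟩ | ⟨rfl, rfl, rfl⟩
    · refine hstar (star_of_perm hp'.symm (Or.inl fun c hc => ?_))
      simp [std, stdKids] at hc
      exact hc.2
    · exact hstar (star_of_perm hp'.symm (Or.inr ⟨K2, rfl, fun c hc => by simpa using hc⟩))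
    · exact hbad (eq_bad_of_perm hp')
  · obtain ⟨b, s, hb, hp⟩ := exists_perm_of_not_star hs
    refine (iso_of_perm hp).symm.good ?_
    have hsz := size_eq_of_perm hp
    have hrb := reduced_of_kids_perm hp hr
    rw [hn] at hsz
    by_cases hss : Star s
    · rcases hrb.2.1.eq_of_star hss with rfl | rfl | rfl
      · exact good_cons_nil ih b hrb.1 hb hsz.symm
      · exact good_cons_K2 ih b hrb.1 hb hsz.symm
      · exact good_cons_P3 ih b hrb.1 hb hsz.symm
    · rw [size_cons] at hsz
      have := size_pos s
      have := size_pos b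
      by_cases hsb : s = bad
      · subst hsb
        -- The rest cannot serve as host, so its two branches `K2` are removed as a pair. What
        -- remains is `b` alone on the root, which is not a star because `b` is not one.
        refine ((Iso.swap _ _ _).trans ((Iso.refl K2).cons (Iso.swap _ _ _))).symm.good
          (pairAttachable_K2_K2.root (ih _ ?_ ?_ ?_))
        · simp only [size_cons, size_nil] at hsz ⊢; omega
        · rintro (h | ⟨c, hc, h⟩)
          · refine hb (Or.inl ?_)
            rw [h b List.mem_cons_self]
            simp [AllNil]
          · cases hc
            exact hb (Or.inl h)
        · intro h; cases h
      · exact (attachable_of_not_star ih b hb (by omega)).root (ih s (by omega) hss hsb)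

lemma good_of_not_star (t : RTree) (hstar : ¬ Star t) (hbad : t ≠ bad) : Good t := by
  induction hn : t.size using Nat.strong_induction_on generalizing t with
  | _ n ih =>
    exact good_step (fun s hs h h' => ih s.size hs s h h' rfl) t hn hstar hbad

/-! ### From rooted plane trees back to graphs -/

lemma exists_add_leaf (s : RTree) : ∀ p : s.Vert, ∃ (t : RTree) (e : Option s.Vert ≃ t.Vert),
    (∀ a c, t.dist (e (some a)) (e (some c)) = s.dist a c) ∧
    (∀ a, t.dist (e none) (e (some a)) = s.dist p a + 1) ∧ e (some s.root) = t.root := by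
  induction s with
  | nil =>
    intro p
    let E : Option Unit ≃ Unit ⊕ Unit := (Equiv.optionEquivSumPUnit _).trans (Equiv.sumComm _ _)
    exact ⟨cons nil nil, E, fun _ _ => rfl, fun _ => rfl, rfl⟩
  | cons b s ihb ihs =>
    rintro (p | p)
    · obtain ⟨t, e, h1, h2, hr⟩ := ihb p
      have hd : ∀ a, t.depth (e (some a)) = b.depth a := fun a => by
        rw [← dist_root, ← hr, h1, dist_root]
      have hd0 : t.depth (e none) = b.depth p + 1 := by
        rw [← dist_root', ← hr, h2, dist_root']
      let E : Option (b.Vert ⊕ s.Vert) ≃ t.Vert ⊕ s.Vert :=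
        { toFun := fun o => o.elim (Sum.inl (e none)) (Sum.map (fun a => e (some a)) id)
          invFun := Sum.elim (fun x => (e.symm x).map Sum.inl) (fun c => some (Sum.inr c))
          left_inv := by rintro (_ | (a | c)) <;> simp
          right_inv := by
            rintro (x | c)
            · obtain ⟨(_ | a), rfl⟩ := e.surjective x <;> simp
            · rfl }
      refine ⟨cons t s, E, ?_, ?_, rfl⟩
      · rintro (a | a) (c | c)
        · exact h1 a c
        · exact congrArg (fun x => x + 1 + s.depth c) (hd a)
        · exact congrArg (fun x => x + 1 + s.depth a) (hd c)
        · rfl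
      · rintro (a | a)
        · exact h2 a
        · change t.depth (e none) + 1 + s.depth a = b.depth p + 1 + s.depth a + 1
          omega
    · obtain ⟨t, e, h1, h2, hr⟩ := ihs p
      have hd : ∀ a, t.depth (e (some a)) = s.depth a := fun a => by
        rw [← dist_root, ← hr, h1, dist_root]
      have hd0 : t.depth (e none) = s.depth p + 1 := by
        rw [← dist_root', ← hr, h2, dist_root']
      let E : Option (b.Vert ⊕ s.Vert) ≃ b.Vert ⊕ t.Vert :=
        { toFun := fun o => o.elim (Sum.inr (e none)) (Sum.map id (fun a => e (some a)))
          invFun := Sum.elim (fun c => some (Sum.inl c)) (fun x => (e.symm x).map Sum.inr)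
          left_inv := by rintro (_ | (a | c)) <;> simp
          right_inv := by
            rintro (c | x)
            · rfl
            · obtain ⟨(_ | a), rfl⟩ := e.surjective x <;> simp }
      refine ⟨cons b t, E, ?_, ?_, congrArg Sum.inr hr⟩
      · rintro (a | a) (c | c)
        · rfl
        · exact congrArg (fun x => b.depth a + 1 + x) (hd c)
        · exact congrArg (fun x => b.depth c + 1 + x) (hd a)
        · exact h1 a c
      · rintro (a | a)
        · change b.depth a + 1 + t.depth (e none) = b.depth a + 1 + s.depth p + 1
          omega
        · exact h2 a

/-- The tree `T` with root `x` is identified with `t`. -/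
structure Represents {V : Type*} (t : RTree) (T : SimpleGraph V) (x : V) (e : t.Vert ≃ V) :
    Prop where
  adj : ∀ a c, T.Adj (e a) (e c) ↔ t.dist a c = 1
  dist_le : ∀ a c, T.dist (e a) (e c) ≤ t.dist a c
  root : e t.root = x

/-- Induction by removing a leaf and adding it back. Only an upper bound on graph distances is
carried along: the remaining conditions concern adjacency, which is matched exactly. -/
lemma exists_represents {V : Type*} [Finite V] (T : SimpleGraph V) (hT : T.IsTree) (x : V) :
    ∃ t e, Represents t T x e := by
  classical
  obtain ⟨n, hn⟩ : ∃ n, Nat.card V = n + 1 :=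
    ⟨Nat.card V - 1, by have : Nonempty V := ⟨x⟩; have := Nat.card_pos (α := V); omega⟩
  induction n generalizing V with
  | zero =>
    have hu : Subsingleton V := (Nat.card_eq_one_iff_unique.1 hn).1
    let e : nil.Vert ≃ V :=
      ⟨fun _ => x, fun _ => nil.root, fun _ => rfl, fun _ => Subsingleton.elim _ _⟩
    refine ⟨nil, e, fun a c => ?_, fun a c => ?_, rfl⟩
    · rw [Subsingleton.elim (e a) (e c)]
      simp
    · rw [Subsingleton.elim (e a) (e c)]
      simp
  | succ n ih =>
    have := Fintype.ofFinite V
    have hnt : Nontrivial V := Finite.one_lt_card_iff_nontrivial.1 (by omega)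
    -- A nontrivial tree has two leaves, so one of them is not the root.
    obtain ⟨z, hzx, hz⟩ : ∃ z, z ≠ x ∧ T.degree z = 1 := by
      obtain ⟨u, v, huv, hu, hv⟩ := hT.exists_ne_and_degree_eq_one
      by_cases h : u = x
      · exact ⟨v, fun h' => huv (h.trans h'.symm), hv⟩
      · exact ⟨u, h, hu⟩
    obtain ⟨p, hzp, hp⟩ := SimpleGraph.degree_eq_one_iff_existsUnique_adj.1 hz
    have hp' : ∀ y, T.Adj z y → y = p := hp
    have hW : (T.induce {z}ᶜ).IsTree :=
      ⟨hT.connected.induce_compl_singleton_of_degree_eq_one hz, hT.isAcyclic.induce _⟩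
    have hcard : Nat.card ({z}ᶜ : Set V) = n + 1 := by
      have := Set.ncard_add_ncard_compl ({z} : Set V)
      rw [Set.ncard_singleton, hn] at this
      change ({z}ᶜ : Set V).ncard = n + 1
      omega
    obtain ⟨s, e, he⟩ := ih (T.induce {z}ᶜ) hW ⟨x, fun h => hzx h.symm⟩ hcard
    obtain ⟨t, E, h1, h2, hr⟩ := exists_add_leaf s (e.symm ⟨p, fun h => hzp.ne h.symm⟩)
    set p' := e.symm ⟨p, fun h => hzp.ne h.symm⟩ with hp'_def
    have hep : (e p' : V) = p := by simp [hp'_def]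
    let g : Option s.Vert → V := fun o => o.elim z fun a => (e a : V)
    have hg : Function.Bijective g := by
      constructor
      · rintro (_ | a) (_ | c) hac
        · rfl
        · exact absurd hac.symm (e c).2
        · exact absurd hac (e a).2
        · exact congrArg some (e.injective (Subtype.ext hac))
      · intro y
        by_cases hy : y = z
        · exact ⟨none, hy.symm⟩
        · exact ⟨some (e.symm ⟨y, hy⟩), by simp [g]⟩
    let G := Equiv.ofBijective g hg
    have hGs : ∀ a, (E.symm.trans G) (E (some a)) = e a := fun a => by simp [G, g]
    have hGn : (E.symm.trans G) (E none) = z := by simp [G, g]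
    have hadj : ∀ a, T.Adj z (e a) ↔ s.dist p' a + 1 = 1 := by
      intro a
      constructor
      · intro h
        have : e a = e p' := Subtype.ext ((hp' _ h).trans hep.symm)
        rw [e.injective this, dist_self]
      · intro h
        rw [← s.eq_of_dist p' a (by omega), hep]
        exact hzp
    have hdist : ∀ a c, T.dist (e a) (e c) ≤ s.dist a c := by
      intro a c
      obtain ⟨w, hw⟩ := hW.connected.exists_walk_length_eq_dist (e a) (e c)
      refine le_trans ?_ (he.dist_le a c)
      rw [← hw]
      have := SimpleGraph.dist_le (w.map (SimpleGraph.Embedding.induce _).toHom)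
      rw [SimpleGraph.Walk.length_map] at this
      exact this
    have hdist' : ∀ a, T.dist z (e a) ≤ s.dist p' a + 1 := by
      intro a
      have h3 := hT.connected.dist_triangle (u := z) (v := p) (w := e a)
      have h4 := hdist p' a
      rw [hep] at h4
      have h5 := SimpleGraph.dist_eq_one_iff_adj.2 hzp
      omega
    refine ⟨t, E.symm.trans G, ?_, ?_, ?_⟩
    · intro a c
      obtain ⟨(_ | a), rfl⟩ := E.surjective a <;> obtain ⟨(_ | c), rfl⟩ := E.surjective c
      · simp
      · rw [hGs, hGn, h2]
        exact hadj c
      · rw [hGs, hGn, t.dist_comm, h2, T.adj_comm]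
        exact hadj a
      · rw [hGs, hGs, h1]
        exact he.adj a c
    · intro a c
      obtain ⟨(_ | a), rfl⟩ := E.surjective a <;> obtain ⟨(_ | c), rfl⟩ := E.surjective c
      · simp
      · rw [hGs, hGn, h2]
        exact hdist' c
      · rw [hGs, hGn, t.dist_comm, h2, T.dist_comm]
        exact hdist' a
      · rw [hGs, hGs, h1]
        exact hdist a c
    · rw [← hr, hGs, he.root]

lemma AllNil.dist_eq_one_iff : (t : RTree) → AllNil t → ∀ a c : t.Vert,
    t.dist a c = 1 ↔ a ≠ c ∧ (a = t.root ∨ c = t.root)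
  | nil, _, a, c => by simp [vert_nil_eq a c]
  | cons b s, h, a, c => by
    obtain rfl : b = nil := h b List.mem_cons_self
    have ih := AllNil.dist_eq_one_iff s fun b hb => h b (List.mem_cons_of_mem _ hb)
    rcases a with a | a <;> rcases c with c | c
    · have : (Sum.inl a : (cons nil s).Vert) = Sum.inl c := congrArg Sum.inl (vert_nil_eq a c)
      rw [this]
      simp
    · rw [dist_inl_inr, depth_nil]
      constructor
      · intro h
        exact ⟨nofun, Or.inr (congrArg Sum.inr (s.eq_root_of_depth c (by omega)))⟩
      · rintro ⟨-, h | h⟩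
        · cases h
        · rw [Sum.inr.inj h, depth_root]
    · rw [dist_inr_inl, depth_nil]
      constructor
      · intro h
        exact ⟨nofun, Or.inl (congrArg Sum.inr (s.eq_root_of_depth a (by omega)))⟩
      · rintro ⟨-, h | h⟩
        · rw [Sum.inr.inj h, depth_root]
        · cases h
    · rw [dist_inr_inr, ih a c]
      constructor
      · rintro ⟨h1, h2⟩
        exact ⟨fun h => h1 (Sum.inr.inj h), h2.imp (congrArg Sum.inr) (congrArg Sum.inr)⟩
      · rintro ⟨h1, h2⟩
        exact ⟨fun h => h1 (congrArg Sum.inr h),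
          h2.imp (fun h => Sum.inr.inj h) fun h => Sum.inr.inj h⟩

lemma Star.exists_center {t : RTree} (h : Star t) : ∃ r : t.Vert, ∀ a c : t.Vert,
    t.dist a c = 1 ↔ a ≠ c ∧ (a = r ∨ c = r) := by
  rcases h with h | ⟨b, rfl, h⟩
  · exact ⟨t.root, AllNil.dist_eq_one_iff t h⟩
  · have ih := AllNil.dist_eq_one_iff b h
    refine ⟨Sum.inl b.root, ?_⟩
    rintro (a | a) (c | c)
    · rw [dist_inl_inl, ih a c]
      constructor
      · rintro ⟨h1, h2⟩
        exact ⟨fun h => h1 (Sum.inl.inj h), h2.imp (congrArg Sum.inl) (congrArg Sum.inl)⟩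
      · rintro ⟨h1, h2⟩
        exact ⟨fun h => h1 (congrArg Sum.inl h),
          h2.imp (fun h => Sum.inl.inj h) fun h => Sum.inl.inj h⟩
    · rw [dist_inl_inr, depth_nil]
      constructor
      · intro h
        exact ⟨nofun, Or.inl (congrArg Sum.inl (b.eq_root_of_depth a (by omega)))⟩
      · rintro ⟨-, h | h⟩
        · rw [Sum.inl.inj h, depth_root]
        · cases h
    · rw [dist_inr_inl, depth_nil]
      constructor
      · intro h
        exact ⟨nofun, Or.inr (congrArg Sum.inl (b.eq_root_of_depth c (by omega)))⟩
      · rintro ⟨-, h | h⟩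
        · cases h
        · rw [Sum.inl.inj h, depth_root]
    · have : (Sum.inr a : (cons b nil).Vert) = Sum.inr c := congrArg Sum.inr (vert_nil_eq a c)
      rw [this]
      simp

variable {V : Type*} {T : SimpleGraph V} {x : V} {t : RTree} {e : t.Vert ≃ V}

lemma Represents.isStar (he : Represents t T x e) (h : Star t) : IsStar T := by
  obtain ⟨r, hr⟩ := h.exists_center
  refine ⟨e r, ?_⟩
  ext u v
  obtain ⟨a, rfl⟩ := e.surjective u
  obtain ⟨c, rfl⟩ := e.surjective v
  rw [he.adj, hr, SimpleGraph.starGraph_adj]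
  simp

lemma Represents.isBadVertex {e : bad.Vert ≃ V} (he : Represents bad T x e) :
    IsBadVertex T x := by
  -- The vertices of `bad` are listed as leaf, child, leaf, child, root; the table reorders them
  -- along the path, with the root in the middle.
  let g : Fin 5 → bad.Vert := fun i => vertAt bad ([0, 1, 4, 3, 2].getD i 0)
  have hg : Function.Bijective g := by
    constructor
    · decide +kernel
    · decide +kernel
  have hd : ∀ i j : Fin 5, bad.dist (g i) (g j) = 1 ↔ i.val + 1 = j.val ∨ j.val + 1 = i.val := by
    decide +kernel
  refine ⟨⟨(Equiv.ofBijective g hg).trans e, ?_⟩, he.root⟩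
  intro i j
  change T.Adj (e (g i)) (e (g j)) ↔ _
  rw [he.adj, hd, SimpleGraph.pathGraph_adj]

lemma Represents.exists_isGoodTwoPlacement (he : Represents t T x e) (hT : T.Connected)
    (h : t.Good) : ∃ σ : Equiv.Perm V, IsGoodTwoPlacement T x σ := by
  obtain ⟨f, hf⟩ := h
  have hbij : Function.Bijective f := Finite.injective_iff_bijective.1 hf.inj
  let σ : Equiv.Perm V := (e.symm.trans (Equiv.ofBijective f hbij)).trans e
  have hσ : ∀ a, σ (e a) = e (f a) := fun a => by simp [σ]
  refine ⟨σ, ?_, ?_, ?_, ?_, ?_, ?_⟩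
  · intro v hv
    obtain ⟨a, rfl⟩ := e.surjective v
    rw [hσ] at hv
    exact hf.ne a (e.injective hv)
  · intro u v huv
    obtain ⟨a, rfl⟩ := e.surjective u
    obtain ⟨c, rfl⟩ := e.surjective v
    rw [he.adj] at huv
    rw [hσ, hσ, he.adj]
    exact (hf.edge a c huv).1
  · intro u' v' huv
    obtain ⟨hne, u, v, huv, rfl, rfl⟩ := huv
    refine ⟨hne, hT.preconnected _ _, ?_⟩
    obtain ⟨a, rfl⟩ := e.surjective u
    obtain ⟨c, rfl⟩ := e.surjective v
    rw [he.adj] at huv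
    rw [hσ, hσ]
    exact (he.dist_le _ _).trans (hf.edge a c huv).2
  · rw [← he.root, hσ, SimpleGraph.dist_eq_one_iff_adj, he.adj]
    exact hf.base
  · intro y hy
    obtain ⟨a, rfl⟩ := e.surjective y
    rw [← he.root, he.adj] at hy
    rw [hσ]
    exact (he.dist_le _ _).trans (hf.nbr a hy)
  · intro y _
    obtain ⟨a, rfl⟩ := e.surjective y
    rw [hσ]
    exact (he.dist_le _ _).trans (hf.le_four a)

end RTree
end TreePlacement

theorem theorem1p8 {V : Type*} [Finite V] (T : SimpleGraph V) (hT : T.IsTree)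
    (hstar : ¬ TreePlacement.IsStar T) (x : V) (hx : ¬ TreePlacement.IsBadVertex T x) :
    ∃ σ : Equiv.Perm V, TreePlacement.IsGoodTwoPlacement T x σ := by
  obtain ⟨t, e, he⟩ := TreePlacement.RTree.exists_represents T hT x
  refine he.exists_isGoodTwoPlacement hT.connected
    (TreePlacement.RTree.good_of_not_star t (fun h => hstar (he.isStar h)) ?_)
  rintro rfl
  exact hx he.isBadVertex
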